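/- Let $m\ge 1$, $0<L\le\infty$, and let $w:[0,L)\to[0,\infty)$ be smooth with $w(0)=0$, $w'(0)=1$, $w^{(k)}(0)=0$ for all even $k$, and $w(r)>0$ for $r>0$. Let $M^m_w=[0,L)\times_w S^{m-1}$ be the model space with center point $p$ and metric $dr^2+w(r)^2\,d\theta^2$, where $d\theta^2$ is the standard metric of the unit sphere $S^{m-1}$ and $r$ is the distance to $p$; let $\Delta$ be its Laplace--Beltrami operator and $dV$ its Riemannian volume. For $0<R<L$ let $B=B^w_R$ be the open geodesic ball of radius $R$ about $p$. Call $\lambda\in\mathbb{R}$ a Dirichlet eigenvalue of $B$ if there is a function $v\not\equiv 0$ in $C^2(B)\cap C(\overline B)$ with $\Delta v+\lambda v=0$ on $B$ and $v=0$ on $\partial B$. Let $u_0=1$ on $B$ and, for $k\ge 1$, let $u_k\in C^2(B)\cap C(\overline B)$ solve $$\Delta u_k+k\,u_{k-1}=0 \ \text{ on } B,\qquad u_k=0\ \text{ on }\partial B,$$ and put $\mathcal{A}_k(B)=\int_B u_k\,dV$ for $k\ge 0$. Then $B$ has a smallest Dirichlet eigenvalue $\lambda_1(B)$, such a sequence $(u_k)$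 exists, and for every such sequence and every $k\ge 1$: $u_k>0$ on $B$ and $\mathcal{A}_k(B)>0$; the quotient $k\,u_{k-1}/u_k$ is a radial function on $B$ that is (strictly) increasing in $r\in[0,R)$; and $$\frac{k\,u_{k-1}(p)}{u_k(p)}\ \le\ \lambda_1(B)\ \le\ \frac{k\,\mathcal{A}_{k-1}(B)}{\mathcal{A}_k(B)}.$$ -/

import Mathlib

open scoped ContDiff

namespace WarpedModel

noncomputable section

/-! ### Riemannian metrics in a global chart

A Riemannian metric on an open subset of `ℝ^m` is given by its Gram matrix
`(g_{ij}(x))` in the Cartesian coordinates. -/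

/-- The coordinate space `ℝ^m` with its Euclidean norm. -/
abbrev Coord (m : ℕ) : Type := EuclideanSpace ℝ (Fin m)

/-- The density `√(det g)` of the Riemannian volume `dV = √(det g) dx`. -/
def volumeDensity {m : ℕ} (g : Coord m → Matrix (Fin m) (Fin m) ℝ) (x : Coord m) : ℝ :=
  Real.sqrt (g x).det

/-- The integral `∫_D u dV` against the Riemannian volume. -/
def volumeIntegral {m : ℕ} (g : Coord m → Matrix (Fin m) (Fin m) ℝ) (D : Set (Coord m))
    (u : Coord m → ℝ) : ℝ :=
  ∫ x in D, u x * volumeDensity g x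

/-- The partial derivative `∂u / ∂x_i`. -/
def partialDeriv {m : ℕ} (i : Fin m) (u : Coord m → ℝ) (x : Coord m) : ℝ :=
  fderiv ℝ u x (EuclideanSpace.single i 1)

/-- The Laplace-Beltrami operator
`Δ u = (det g)^{-1/2} ∑_i ∂_i ((det g)^{1/2} ∑_j g^{ij} ∂_j u)`. -/
def laplaceBeltrami {m : ℕ} (g : Coord m → Matrix (Fin m) (Fin m) ℝ) (u : Coord m → ℝ)
    (x : Coord m) : ℝ :=
  (volumeDensity g x)⁻¹ *
    ∑ i, partialDeriv i
      (fun y => volumeDensity g y * ∑ j, (g y)⁻¹ i j * partialDeriv j u y) x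

/-- The Riemannian length of the curve `γ : [0, 1] → ℝ^m`. -/
def curveLength {m : ℕ} (g : Coord m → Matrix (Fin m) (Fin m) ℝ) (γ : ℝ → Coord m) : ℝ :=
  ∫ t in (0 : ℝ)..1, Real.sqrt
    ((derivWithin γ (Set.Icc 0 1) t).ofLp ⬝ᵥ
      (g (γ t)).mulVec (derivWithin γ (Set.Icc 0 1) t).ofLp)

/-- The open ball of radius `R` about `p` for the Riemannian distance of `(M, g)`. As the distance
is the infimum of the lengths of the `C^1` curves in `M`, a point has distance less than `R`
from `p` exactly if it is joined to `p` by such a curve of length less than `R`. -/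
def geodesicBall {m : ℕ} (g : Coord m → Matrix (Fin m) (Fin m) ℝ) (M : Set (Coord m))
    (p : Coord m) (R : ℝ) : Set (Coord m) :=
  {x | ∃ γ : ℝ → Coord m, ContDiffOn ℝ 1 γ (Set.Icc 0 1) ∧ Set.MapsTo γ (Set.Icc 0 1) M ∧
    γ 0 = p ∧ γ 1 = x ∧ curveLength g γ < R}

/-! ### Dirichlet problems on a domain -/

/-- `lam` is a Dirichlet eigenvalue of `D`: there is a nonzero classical solution `v` of
`Δ v + lam v = 0` on `D`, `v = 0` on `∂D`. -/
def IsDirichletEigenvalue {m : ℕ} (g : Coord m → Matrix (Fin m) (Fin m) ℝ) (D : Set (Coord m))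
    (lam : ℝ) : Prop :=
  ∃ v : Coord m → ℝ, ContDiffOn ℝ 2 v D ∧ ContinuousOn v (closure D) ∧
    (∀ x ∈ D, laplaceBeltrami g v x + lam * v x = 0) ∧
    (∀ x ∈ frontier D, v x = 0) ∧ ∃ x ∈ D, v x ≠ 0

/-- The first Dirichlet eigenvalue of `D`. -/
def firstDirichletEigenvalue {m : ℕ} (g : Coord m → Matrix (Fin m) (Fin m) ℝ)
    (D : Set (Coord m)) : ℝ :=
  sInf {lam : ℝ | IsDirichletEigenvalue g D lam}

/-- `u` is the sequence of exit time moment functions of `D`: `u_0 = 1` on `D` and, for `k ≥ 1`,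
`u_k` is a classical solution of `Δ u_k + k u_{k-1} = 0` on `D`, `u_k = 0` on `∂D`. -/
structure IsMomentSequence {m : ℕ} (g : Coord m → Matrix (Fin m) (Fin m) ℝ)
    (D : Set (Coord m)) (u : ℕ → Coord m → ℝ) : Prop where
  zero : ∀ x ∈ D, u 0 x = 1
  contDiffOn : ∀ k : ℕ, 1 ≤ k → ContDiffOn ℝ 2 (u k) D
  continuousOn : ∀ k : ℕ, 1 ≤ k → ContinuousOn (u k) (closure D)
  equation : ∀ k : ℕ, 1 ≤ k → ∀ x ∈ D, laplaceBeltrami g (u k) x + k * u (k - 1) x = 0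
  boundary : ∀ k : ℕ, 1 ≤ k → ∀ x ∈ frontier D, u k x = 0

/-! ### Model spaces -/

/-- The base interval `[0, L[`, where `L ≤ ∞`. -/
def base (L : EReal) : Set ℝ := {r : ℝ | 0 ≤ r ∧ (r : EReal) < L}

/-- `w : [0, L[ → [0, ∞[` is the warping function of a model space. -/
structure IsWarpingFunction (L : EReal) (w : ℝ → ℝ) : Prop where
  smooth : ContDiffOn ℝ ∞ w (base L)
  map_zero : w 0 = 0
  deriv_zero : derivWithin w (base L) 0 = 1
  even_deriv_zero : ∀ k : ℕ, Even k → iteratedDerivWithin k w (base L) 0 = 0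
  pos : ∀ r ∈ base L, 0 < r → 0 < w r

/-- The underlying manifold of the model space in geodesic polar coordinates: the pair
`(r, θ) ∈ [0, L[ × S^{m-1}` is the point `x = r θ`, and the center point is `x = 0`. -/
def modelCarrier (m : ℕ) (L : EReal) : Set (Coord m) := {x | (‖x‖ : EReal) < L}

/-- The warped product metric `dr² + w(r)² dθ²` at `x = r θ`. In Cartesian coordinates
`dr²` is the matrix `P = θ θᵀ` of the radial projection, and `dθ²`, the pull-back of the
standard metric of the unit sphere under `x ↦ x / ‖x‖`, is `r⁻² (1 - P)`. At the center point it
is the Euclidean metric, the continuous (in fact smooth) extension. -/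
def modelMetric (m : ℕ) (w : ℝ → ℝ) (x : Coord m) : Matrix (Fin m) (Fin m) ℝ :=
  if x = 0 then 1
  else
    Matrix.vecMulVec (‖x‖⁻¹ • x).ofLp (‖x‖⁻¹ • x).ofLp +
      (w ‖x‖) ^ 2 • ((‖x‖ ^ 2)⁻¹ •
        (1 - Matrix.vecMulVec (‖x‖⁻¹ • x).ofLp (‖x‖⁻¹ • x).ofLp))

/-- The geodesic ball `B^w_R` about the center point of the `m`-dimensional model space with
base `[0, L[` and warping function `w`. -/
def modelBall (m : ℕ) (L : EReal) (w : ℝ → ℝ) (R : ℝ) : Set (Coord m) :=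
  geodesicBall (modelMetric m w) (modelCarrier m L) 0 R

end

end WarpedModel

/-! Put w(r) = r η(r) and d = m - 1. On radial functions the Dirichlet problem Δf = -g is inverted
by the positive operator (Gg)(r) = ∫_r^R w(s)^{-d} ∫_0^s w^d g dx ds. With G_k = G^k 1
(`momentProfile`), uniqueness gives u_k = k! G_k.

A quotient of integrals inherits strict monotonicity from the quotient of the integrands
(`integral_mul_integral_lt`). Used for both integrations in G, this shows by induction that
G_k/G_{k+1} is strictly increasing (`momentProfile_mul_lt`). Let c_k be its value at the center;
since G is positive, c_k G_{k+1} ≤ G_k implies c_k ≤ c_{k+1}. The quotient of the fluxes of G_k and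
G_{k+1} is increasing too, and its value a_k at R is the quotient of moments in the theorem. Hence
G_{k+1} ≤ a_k G_{k+2}, and iterating G gives c_n ≤ a_k for all n. So λ = sup c_k satisfies both
bounds.

It remains to see that λ is the first eigenvalue. The normalised profiles G_k/G_k(0) decrease to a
radial eigenfunction for λ (`exists_radial_eigenfunction`). For 0 ≤ μ < λ a finite combination of
the G_j is a positive strict supersolution on the closed ball
(`IsProfile.exists_strictSupersolution`), and the maximum principle then excludes every
eigenfunction for μ, radial or not. The case μ = 0 gives uniqueness of the u_k.

The geometry enters through `IsWarpingFunction.modelBall_eq`,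
`IsProfile.laplaceBeltrami_radialGreen` and `IsProfile.volumeIntegral_radial`; smoothness at the
center rests on w''(0) = 0. -/

namespace WarpedModel

noncomputable section

/-! ### The radial Green operator -/

/-- The normalised flux `s^{-(d+1)} ∫_0^s (x η(x))^d g(x) dx`, written without singularity. -/
def radialFlux (d : ℕ) (η g : ℝ → ℝ) (s : ℝ) : ℝ :=
  ∫ t in (0 : ℝ)..1, t ^ d * η (s * t) ^ d * g (s * t)

/-- The radial Green operator of the ball of radius `R` for the warping function `r η(r)`. -/
def radialGreen (d : ℕ) (η : ℝ → ℝ) (R : ℝ) (g : ℝ → ℝ) (r : ℝ) : ℝ :=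
  ∫ s in r..R, s / η s ^ d * radialFlux d η g s

/-- The radial profiles `u_k / k!` of the exit time moments. -/
def momentProfile (d : ℕ) (η : ℝ → ℝ) (R : ℝ) : ℕ → ℝ → ℝ
  | 0 => fun _ => 1
  | k + 1 => radialGreen d η R (momentProfile d η R k)

variable {d : ℕ} {η g h : ℝ → ℝ} {R : ℝ}

lemma continuous_radialFlux (hη : Continuous η) (hg : Continuous g) :
    Continuous (radialFlux d η g) := by
  unfold radialFlux
  apply intervalIntegral.continuous_parametric_intervalIntegral_of_continuous'
  fun_prop

lemma radialFlux_zero (hη0 : η 0 = 1) : radialFlux d η g 0 = g 0 / (d + 1) := by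
  simp [radialFlux, hη0, div_eq_inv_mul]

/-- Substitution x = s t. Since (x η(x))^d = w^d, the integrand of `radialGreen` is w(s)^{-d} ∫_0^s
w^d g away from s = 0. -/
lemma pow_mul_radialFlux (s : ℝ) :
    s ^ (d + 1) * radialFlux d η g s = ∫ x in (0 : ℝ)..s, (x * η x) ^ d * g x := by
  have h := intervalIntegral.mul_integral_comp_mul_left (a := 0) (b := 1)
    (f := fun x => (x * η x) ^ d * g x) (c := s)
  rw [mul_zero, mul_one] at h
  rw [← h, pow_succ', mul_assoc, radialFlux, ← intervalIntegral.integral_const_mul]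
  congr 1
  refine intervalIntegral.integral_congr fun t _ => ?_
  simp only [mul_pow]
  ring

lemma hasDerivAt_radialFlux (hη : Continuous η) (hg : Continuous g) {s : ℝ} (hs : s ≠ 0) :
    HasDerivAt (radialFlux d η g) ((η s ^ d * g s - (d + 1) * radialFlux d η g s) / s) s := by
  have hc : Continuous fun x => (x * η x) ^ d * g x := by fun_prop
  have h1 : HasDerivAt (fun s => ∫ x in (0 : ℝ)..s, (x * η x) ^ d * g x)
      ((s * η s) ^ d * g s) s := (hc.integral_hasStrictDerivAt 0 s).hasDerivAt
  have h2 : HasDerivAt (fun s : ℝ => s ^ (d + 1)) ((d + 1 : ℕ) * s ^ d) s := by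
    simpa using hasDerivAt_pow (d + 1) s
  have h3 := h1.div h2 (pow_ne_zero _ hs)
  have hev : radialFlux d η g =ᶠ[nhds s]
      (fun s => ∫ x in (0 : ℝ)..s, (x * η x) ^ d * g x) / fun s => s ^ (d + 1) := by
    filter_upwards [isOpen_ne.mem_nhds hs] with y hy
    simp only [Pi.div_apply]
    rw [← pow_mul_radialFlux, mul_div_cancel_left₀ _ (pow_ne_zero _ hy)]
  refine (h3.congr_of_eventuallyEq hev).congr_deriv ?_
  rw [← pow_mul_radialFlux]
  push_cast
  field_simp
  ring

lemma continuous_radialGreen_integrand (hη : Continuous η) (hpos : ∀ r, 0 < η r)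
    (hg : Continuous g) : Continuous fun s => s / η s ^ d * radialFlux d η g s :=
  (continuous_id.div (hη.pow d) fun s => (pow_pos (hpos s) d).ne').mul
    (continuous_radialFlux hη hg)

lemma hasDerivAt_radialGreen (hη : Continuous η) (hpos : ∀ r, 0 < η r) (hg : Continuous g)
    (r : ℝ) : HasDerivAt (radialGreen d η R g) (-(r / η r ^ d * radialFlux d η g r)) r := by
  have hc := continuous_radialGreen_integrand (d := d) hη hpos hg
  exact intervalIntegral.integral_hasDerivAt_left (hc.intervalIntegrable _ _)
    hc.aestronglyMeasurable.stronglyMeasurableAtFilter hc.continuousAt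

lemma continuous_radialGreen (hη : Continuous η) (hpos : ∀ r, 0 < η r) (hg : Continuous g) :
    Continuous (radialGreen d η R g) :=
  continuous_iff_continuousAt.2 fun r => (hasDerivAt_radialGreen hη hpos hg r).continuousAt

@[simp] lemma radialGreen_self : radialGreen d η R g R = 0 := by simp [radialGreen]

lemma continuous_momentProfile (hη : Continuous η) (hpos : ∀ r, 0 < η r) :
    ∀ k, Continuous (momentProfile d η R k)
  | 0 => continuous_const
  | k + 1 => continuous_radialGreen hη hpos (continuous_momentProfile hη hpos k)

lemma radialFlux_const_mul (c s : ℝ) :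
    radialFlux d η (fun r => c * g r) s = c * radialFlux d η g s := by
  simp only [radialFlux, ← intervalIntegral.integral_const_mul]
  refine intervalIntegral.integral_congr fun t _ => ?_
  ring

lemma radialGreen_const_mul (c r : ℝ) :
    radialGreen d η R (fun r => c * g r) r = c * radialGreen d η R g r := by
  simp only [radialGreen, ← intervalIntegral.integral_const_mul, radialFlux_const_mul]
  refine intervalIntegral.integral_congr fun t _ => ?_
  ring

lemma radialFlux_mono (hη : Continuous η) (hpos : ∀ r, 0 < η r) (hg : Continuous g)
    (hh : Continuous h) (hle : ∀ r ∈ Set.Icc 0 R, g r ≤ h r) {s : ℝ} (hs : s ∈ Set.Icc 0 R) :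
    radialFlux d η g s ≤ radialFlux d η h s := by
  refine intervalIntegral.integral_mono_on zero_le_one
    (Continuous.intervalIntegrable (by fun_prop) _ _)
    (Continuous.intervalIntegrable (by fun_prop) _ _) fun t ht => ?_
  have := hle (s * t) ⟨mul_nonneg hs.1 ht.1, (mul_le_of_le_one_right hs.1 ht.2).trans hs.2⟩
  have h1 := pow_nonneg (hpos (s * t)).le d
  have h2 := pow_nonneg ht.1 d
  gcongr

lemma radialGreen_mono (hη : Continuous η) (hpos : ∀ r, 0 < η r) (hg : Continuous g)
    (hh : Continuous h) (hle : ∀ r ∈ Set.Icc 0 R, g r ≤ h r) {r : ℝ} (hr : r ∈ Set.Icc 0 R) :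
    radialGreen d η R g r ≤ radialGreen d η R h r := by
  refine intervalIntegral.integral_mono_on hr.2
    ((continuous_radialGreen_integrand hη hpos hg).intervalIntegrable _ _)
    ((continuous_radialGreen_integrand hη hpos hh).intervalIntegrable _ _) fun s hs => ?_
  have h0 : 0 ≤ s := hr.1.trans hs.1
  have := radialFlux_mono (d := d) hη hpos hg hh hle ⟨h0, hs.2⟩
  have h1 := pow_pos (hpos s) d
  gcongr

lemma radialFlux_pos (hη : Continuous η) (hpos : ∀ r, 0 < η r) (hg : Continuous g)
    (hgpos : ∀ r ∈ Set.Ico 0 R, 0 < g r) {s : ℝ} (hs : s ∈ Set.Icc 0 R) (hR : 0 < R) :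
    0 < radialFlux d η g s := by
  refine intervalIntegral.intervalIntegral_pos_of_pos_on
    (Continuous.intervalIntegrable (by fun_prop) _ _) (fun t ht => ?_) zero_lt_one
  have hst : s * t < R := by
    rcases hs.1.eq_or_lt with h | h
    · simpa [← h] using hR
    · exact (mul_lt_of_lt_one_right h ht.2).trans_le hs.2
  have := hgpos (s * t) ⟨mul_nonneg hs.1 ht.1.le, hst⟩
  have h1 := pow_pos (hpos (s * t)) d
  have h2 := pow_pos ht.1 d
  positivity

lemma radialGreen_strictAnti (hη : Continuous η) (hpos : ∀ r, 0 < η r) (hg : Continuous g)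
    (hgpos : ∀ r ∈ Set.Ico 0 R, 0 < g r) (hR : 0 < R) {r s : ℝ} (hr : 0 ≤ r) (hrs : r < s)
    (hs : s ≤ R) : radialGreen d η R g s < radialGreen d η R g r := by
  have hc := continuous_radialGreen_integrand (d := d) hη hpos hg
  have := intervalIntegral.integral_add_adjacent_intervals (hc.intervalIntegrable r s)
    (hc.intervalIntegrable (μ := MeasureTheory.volume) s R)
  simp only [radialGreen]
  rw [← this]
  refine lt_add_of_pos_left _ ?_
  refine intervalIntegral.intervalIntegral_pos_of_pos_on (hc.intervalIntegrable _ _)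
    (fun t ht => ?_) hrs
  have h1 := radialFlux_pos (d := d) hη hpos hg hgpos
    ⟨hr.trans ht.1.le, ht.2.le.trans hs⟩ hR
  have h2 := pow_pos (hpos t) d
  have h3 : 0 < t := hr.trans_lt ht.1
  positivity

lemma momentProfile_pos (hη : Continuous η) (hpos : ∀ r, 0 < η r) (hR : 0 < R) (k : ℕ) :
    ∀ r ∈ Set.Ico 0 R, 0 < momentProfile d η R k r := by
  induction k with
  | zero => intro r _; exact zero_lt_one
  | succ k ih =>
    intro r hr
    have := radialGreen_strictAnti (d := d) hη hpos (continuous_momentProfile hη hpos k) ih hR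
      hr.1 hr.2 le_rfl
    simpa [momentProfile] using this

lemma momentProfile_succ_self (k : ℕ) : momentProfile d η R (k + 1) R = 0 := radialGreen_self

lemma momentProfile_nonneg (hη : Continuous η) (hpos : ∀ r, 0 < η r) (hR : 0 < R) (k : ℕ) :
    ∀ r ∈ Set.Icc 0 R, 0 ≤ momentProfile d η R k r := by
  intro r hr
  rcases hr.2.lt_or_eq with h | rfl
  · exact (momentProfile_pos hη hpos hR k r ⟨hr.1, h⟩).le
  · cases k with
    | zero => exact zero_le_one
    | succ k => exact (momentProfile_succ_self k).ge

/-! ### Monotonicity of quotients -/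

/-- Integral form of the monotone l'Hôpital rule, with f/h increasing: the quotient of integrals
over (a, b) lies below f(b)/h(b), the one over (b, c) above. Cross-multiplying avoids dividing by h,
which may vanish at a and c. -/
lemma integral_mul_integral_lt {a b c : ℝ} {p f h : ℝ → ℝ} (hab : a < b) (hbc : b < c)
    (hp : Continuous p) (hf : Continuous f) (hh : Continuous h)
    (hppos : ∀ x ∈ Set.Ioo a c, 0 < p x) (hhpos : ∀ x ∈ Set.Ioo a c, 0 < h x)
    (hlt : ∀ x y, a < x → x < y → y < c → f x * h y < f y * h x) :
    (∫ x in a..b, p x * f x) * (∫ x in b..c, p x * h x) <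
      (∫ x in b..c, p x * f x) * ∫ x in a..b, p x * h x := by
  have hhb := hhpos b ⟨hab, hbc⟩
  have key : ∀ u v : ℝ, ∀ F : ℝ → ℝ, u < v → Continuous F → (∀ x ∈ Set.Ioo u v, 0 < F x) →
      0 < ∫ x in u..v, F x := fun u v F huv hF hpos =>
    intervalIntegral.intervalIntegral_pos_of_pos_on (hF.intervalIntegrable _ _) hpos huv
  have h1 : 0 < ∫ x in a..b, p x * (f b * h x - f x * h b) :=
    key _ _ _ hab (by fun_prop) fun x hx => mul_pos (hppos x ⟨hx.1, hx.2.trans hbc⟩)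
      (sub_pos.2 (hlt x b hx.1 hx.2 hbc))
  have h2 : 0 < ∫ x in b..c, p x * (f x * h b - f b * h x) :=
    key _ _ _ hbc (by fun_prop) fun x hx => mul_pos (hppos x ⟨hab.trans hx.1, hx.2⟩)
      (sub_pos.2 (hlt b x hab hx.1 hx.2))
  have h3 : 0 < ∫ x in a..b, p x * h x := key _ _ _ hab (by fun_prop) fun x hx =>
    mul_pos (hppos x ⟨hx.1, hx.2.trans hbc⟩) (hhpos x ⟨hx.1, hx.2.trans hbc⟩)
  have h4 : 0 < ∫ x in b..c, p x * h x := key _ _ _ hbc (by fun_prop) fun x hx =>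
    mul_pos (hppos x ⟨hab.trans hx.1, hx.2⟩) (hhpos x ⟨hab.trans hx.1, hx.2⟩)
  have e1 : ∫ x in a..b, p x * (f b * h x - f x * h b) =
      f b * (∫ x in a..b, p x * h x) - h b * ∫ x in a..b, p x * f x := by
    rw [← intervalIntegral.integral_const_mul, ← intervalIntegral.integral_const_mul,
      ← intervalIntegral.integral_sub (Continuous.intervalIntegrable (by fun_prop) _ _)
        (Continuous.intervalIntegrable (by fun_prop) _ _)]
    refine intervalIntegral.integral_congr fun t _ => ?_
    ring
  have e2 : ∫ x in b..c, p x * (f x * h b - f b * h x) =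
      h b * (∫ x in b..c, p x * f x) - f b * ∫ x in b..c, p x * h x := by
    rw [← intervalIntegral.integral_const_mul, ← intervalIntegral.integral_const_mul,
      ← intervalIntegral.integral_sub (Continuous.intervalIntegrable (by fun_prop) _ _)
        (Continuous.intervalIntegrable (by fun_prop) _ _)]
    refine intervalIntegral.integral_congr fun t _ => ?_
    ring
  rw [e1] at h1
  rw [e2] at h2
  have h5 := mul_pos h1 h4
  have h6 := mul_pos h2 h3
  refine lt_of_mul_lt_mul_left ?_ hhb.le
  nlinarith

/-- The quotient of fluxes at t is a mediant of the quotient at s and the quotient of the integrals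
over (s, t), and the latter is larger. -/
lemma radialFlux_mul_lt (hη : Continuous η) (hpos : ∀ r, 0 < η r) (hg : Continuous g)
    (hh : Continuous h) (hhpos : ∀ r ∈ Set.Ioo 0 R, 0 < h r)
    (hlt : ∀ x y, 0 < x → x < y → y < R → g x * h y < g y * h x)
    {s t : ℝ} (hs : 0 < s) (hst : s < t) (ht : t ≤ R) :
    radialFlux d η g s * radialFlux d η h t < radialFlux d η g t * radialFlux d η h s := by
  have hp : Continuous fun x => (x * η x) ^ d := by fun_prop
  have h1 := integral_mul_integral_lt (p := fun x => (x * η x) ^ d) hs hst hp hg hh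
    (fun x hx => pow_pos (mul_pos hx.1 (hpos x)) d)
    (fun x hx => hhpos x ⟨hx.1, hx.2.trans_le ht⟩)
    (fun x y h0 hxy hy => hlt x y h0 hxy (hy.trans_le ht))
  have h2 : ∀ f : ℝ → ℝ, Continuous f → (∫ x in (0 : ℝ)..s, (x * η x) ^ d * f x) +
      ∫ x in s..t, (x * η x) ^ d * f x = ∫ x in (0 : ℝ)..t, (x * η x) ^ d * f x := fun f hf =>
    intervalIntegral.integral_add_adjacent_intervals
      ((hp.mul hf).intervalIntegrable 0 s) ((hp.mul hf).intervalIntegrable s t)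
  have h3 := h2 g hg
  have h4 := h2 h hh
  rw [← pow_mul_radialFlux, ← pow_mul_radialFlux] at h3 h4
  -- The integrals over (s, t) become differences of integrals from 0; the product of the two
  -- integrals up to s then cancels.
  rw [← pow_mul_radialFlux, ← pow_mul_radialFlux, ← sub_eq_of_eq_add' h3.symm,
    ← sub_eq_of_eq_add' h4.symm] at h1
  have h5 : 0 < s ^ (d + 1) * t ^ (d + 1) := by
    have := hs.trans hst
    positivity
  refine lt_of_mul_lt_mul_left ?_ h5.le
  nlinarith

/-- For k = 0 the first profile is 1 and the second strictly decreases. In the induction step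
monotonicity passes to the fluxes, then to the outer integrals over (x, y) and (y, R); both profiles
vanish at R, so the latter are their values at y. -/
lemma momentProfile_mul_lt (hη : Continuous η) (hpos : ∀ r, 0 < η r) (hR : 0 < R) (k : ℕ) :
    ∀ x y, 0 ≤ x → x < y → y < R →
      momentProfile d η R k x * momentProfile d η R (k + 1) y <
        momentProfile d η R k y * momentProfile d η R (k + 1) x := by
  induction k with
  | zero =>
    intro x y hx hxy hy
    simpa [momentProfile] using radialGreen_strictAnti (d := d) hη hpos
      (continuous_momentProfile (d := d) (R := R) hη hpos 0)
      (momentProfile_pos hη hpos hR 0) hR hx hxy hy.le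
  | succ k ih =>
    intro x y hx hxy hy
    have hc := continuous_momentProfile (d := d) (R := R) hη hpos
    have h1 := integral_mul_integral_lt (p := fun s => s / η s ^ d) hxy hy
      (continuous_id.div (hη.pow d) fun s => (pow_pos (hpos s) d).ne')
      (continuous_radialFlux (d := d) hη (hc k)) (continuous_radialFlux (d := d) hη (hc (k + 1)))
      (fun t ht => div_pos (hx.trans_lt ht.1) (pow_pos (hpos t) d))
      (fun t ht => radialFlux_pos hη hpos (hc _) (momentProfile_pos hη hpos hR (k + 1))
        ⟨hx.trans ht.1.le, ht.2.le⟩ hR)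
      (fun s t hs hst ht => radialFlux_mul_lt hη hpos (hc _) (hc _)
        (fun r hr => momentProfile_pos hη hpos hR (k + 1) r ⟨hr.1.le, hr.2⟩)
        (fun a b ha => ih a b ha.le) (hx.trans_lt hs) hst ht.le)
    have h2 : ∀ j, momentProfile d η R (j + 1) x =
        (∫ s in x..y, s / η s ^ d * radialFlux d η (momentProfile d η R j) s) +
          momentProfile d η R (j + 1) y := fun j =>
      have hcf := continuous_radialGreen_integrand (d := d) hη hpos (hc j)
      (intervalIntegral.integral_add_adjacent_intervals
        (hcf.intervalIntegrable (μ := MeasureTheory.volume) x y) (hcf.intervalIntegrable y R)).symm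
    change _ * momentProfile d η R (k + 2) y < momentProfile d η R (k + 1) y * _ at h1
    rw [h2 k, h2 (k + 1)]
    linarith

end

end WarpedModel

namespace WarpedModel

noncomputable section

variable {d : ℕ} {η g h : ℝ → ℝ} {R : ℝ}

/-! ### The first eigenvalue of the radial problem -/

/-- The quotients `k u_{k-1}(p) / u_k(p)`, with the index shifted by one. -/
def momentRatio (d : ℕ) (η : ℝ → ℝ) (R : ℝ) (k : ℕ) : ℝ :=
  momentProfile d η R k 0 / momentProfile d η R (k + 1) 0

/-- The first eigenvalue of the radial Dirichlet problem. -/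
def radialEigenvalue (d : ℕ) (η : ℝ → ℝ) (R : ℝ) : ℝ := ⨆ k, momentRatio d η R k

lemma momentRatio_pos (hη : Continuous η) (hpos : ∀ r, 0 < η r) (hR : 0 < R) (k : ℕ) :
    0 < momentRatio d η R k :=
  div_pos (momentProfile_pos hη hpos hR _ 0 ⟨le_rfl, hR⟩)
    (momentProfile_pos hη hpos hR _ 0 ⟨le_rfl, hR⟩)

lemma strictMonoOn_momentProfile_div (hη : Continuous η) (hpos : ∀ r, 0 < η r) (hR : 0 < R)
    (k : ℕ) : StrictMonoOn
      (fun r => momentProfile d η R k r / momentProfile d η R (k + 1) r) (Set.Ico 0 R) := by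
  intro x hx y hy hxy
  have h1 := momentProfile_pos (d := d) hη hpos hR (k + 1)
  exact (div_lt_div_iff₀ (h1 x hx) (h1 y hy)).2 (momentProfile_mul_lt hη hpos hR k x y hx.1 hxy hy.2)

/-- The increasing quotient is smallest at the center. -/
lemma momentRatio_mul_le (hη : Continuous η) (hpos : ∀ r, 0 < η r) (hR : 0 < R) (k : ℕ)
    {r : ℝ} (hr : r ∈ Set.Icc 0 R) :
    momentRatio d η R k * momentProfile d η R (k + 1) r ≤ momentProfile d η R k r := by
  rcases hr.2.lt_or_eq with h | rfl
  · exact (le_div_iff₀ (momentProfile_pos hη hpos hR (k + 1) r ⟨hr.1, h⟩)).1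
      ((strictMonoOn_momentProfile_div hη hpos hR k).monotoneOn ⟨le_rfl, hR⟩ ⟨hr.1, h⟩ hr.1)
  · rw [momentProfile_succ_self, mul_zero]
    exact momentProfile_nonneg hη hpos hR k r hr

lemma momentProfile_le_mul_succ (hη : Continuous η) (hpos : ∀ r, 0 < η r) {a : ℝ}
    {k : ℕ} (hle : ∀ r ∈ Set.Icc 0 R, momentProfile d η R k r ≤ a * momentProfile d η R (k + 1) r) :
    ∀ r ∈ Set.Icc 0 R, momentProfile d η R (k + 1) r ≤ a * momentProfile d η R (k + 2) r := by
  intro r hr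
  have hc := continuous_momentProfile (d := d) (R := R) hη hpos
  have := radialGreen_mono (d := d) hη hpos (hc k) ((hc (k + 1)).const_mul a) hle hr
  rwa [radialGreen_const_mul] at this

/-- The positive operator G is applied to `momentRatio_mul_le` and the result evaluated at 0. -/
lemma monotone_momentRatio (hη : Continuous η) (hpos : ∀ r, 0 < η r) (hR : 0 < R) :
    Monotone (momentRatio d η R) := by
  refine monotone_nat_of_le_succ fun k => ?_
  have hc := continuous_momentProfile (d := d) (R := R) hη hpos
  have := radialGreen_mono (d := d) hη hpos ((hc (k + 1)).const_mul (momentRatio d η R k)) (hc k)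
    (fun r hr => momentRatio_mul_le hη hpos hR k hr) (r := 0) ⟨le_rfl, hR.le⟩
  rw [radialGreen_const_mul] at this
  exact (le_div_iff₀ (momentProfile_pos hη hpos hR _ 0 ⟨le_rfl, hR⟩)).2 this

/-- The quotient of fluxes is increasing, hence largest at R; this bounds the integrand of one Green
integral by a multiple of the other. -/
lemma momentProfile_le_flux_div_mul (hη : Continuous η) (hpos : ∀ r, 0 < η r) (hR : 0 < R)
    (k : ℕ) {r : ℝ} (hr : r ∈ Set.Icc 0 R) :
    momentProfile d η R (k + 1) r ≤ radialFlux d η (momentProfile d η R k) R /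
      radialFlux d η (momentProfile d η R (k + 1)) R * momentProfile d η R (k + 2) r := by
  have hc := continuous_momentProfile (d := d) (R := R) hη hpos
  have hF := radialFlux_pos (d := d) hη hpos (hc (k + 1)) (momentProfile_pos hη hpos hR (k + 1))
    ⟨hR.le, le_rfl⟩ hR
  have h1 := fun j => continuous_radialGreen_integrand (d := d) hη hpos (hc j)
  change radialGreen _ _ _ _ _ ≤ _ * radialGreen _ _ _ _ _
  unfold radialGreen
  rw [← intervalIntegral.integral_const_mul]
  refine intervalIntegral.integral_mono_on hr.2 ((h1 k).intervalIntegrable _ _)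
    (((h1 (k + 1)).const_mul _).intervalIntegrable _ _) fun s hs => ?_
  have hs0 : 0 ≤ s := hr.1.trans hs.1
  rw [mul_left_comm]
  refine mul_le_mul_of_nonneg_left ?_ (div_nonneg hs0 (pow_pos (hpos s) d).le)
  rw [div_mul_eq_mul_div, le_div_iff₀ hF]
  have key : ∀ t, 0 < t → t ≤ R → radialFlux d η (momentProfile d η R k) t *
      radialFlux d η (momentProfile d η R (k + 1)) R ≤
      radialFlux d η (momentProfile d η R k) R * radialFlux d η (momentProfile d η R (k + 1)) t := by
    intro t ht htR
    rcases htR.eq_or_lt with rfl | hlt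
    · rfl
    · exact (radialFlux_mul_lt hη hpos (hc k) (hc (k + 1))
        (fun x hx => momentProfile_pos hη hpos hR (k + 1) x ⟨hx.1.le, hx.2⟩)
        (fun x y hx => momentProfile_mul_lt hη hpos hR k x y hx.le) ht hlt le_rfl).le
  -- The flux comparison needs s > 0; at s = 0 it follows by continuity.
  rcases hs0.eq_or_lt with rfl | hpos'
  · have hcl : (0 : ℝ) ∈ closure (Set.Ioc 0 R) := by
      rw [closure_Ioc hR.ne]
      exact ⟨le_rfl, hR.le⟩
    exact le_on_closure (fun t ht => key t ht.1 ht.2)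
      ((continuous_radialFlux hη (hc k)).mul continuous_const).continuousOn
      (continuous_const.mul (continuous_radialFlux hη (hc (k + 1)))).continuousOn hcl
  · exact key s hpos' hs.2

/-- Applying G repeatedly carries the inequality to all indices k + j; monotonicity of the ratios
then covers the indices below k. -/
lemma momentRatio_le_of_le_mul (hη : Continuous η) (hpos : ∀ r, 0 < η r) (hR : 0 < R) {a : ℝ}
    {k : ℕ} (hle : ∀ r ∈ Set.Icc 0 R, momentProfile d η R k r ≤ a * momentProfile d η R (k + 1) r)
    (n : ℕ) : momentRatio d η R n ≤ a := by
  have h1 : ∀ j, ∀ r ∈ Set.Icc 0 R,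
      momentProfile d η R (k + j) r ≤ a * momentProfile d η R (k + j + 1) r := by
    intro j
    induction j with
    | zero => exact hle
    | succ j ih => exact momentProfile_le_mul_succ hη hpos ih
  refine (monotone_momentRatio hη hpos hR (Nat.le_add_left n k)).trans ?_
  exact (div_le_iff₀ (momentProfile_pos hη hpos hR _ 0 ⟨le_rfl, hR⟩)).2
    (h1 n 0 ⟨le_rfl, hR.le⟩)

lemma momentRatio_le_flux_div (hη : Continuous η) (hpos : ∀ r, 0 < η r) (hR : 0 < R) (k n : ℕ) :
    momentRatio d η R n ≤ radialFlux d η (momentProfile d η R k) R /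
      radialFlux d η (momentProfile d η R (k + 1)) R :=
  momentRatio_le_of_le_mul hη hpos hR
    (fun _ hr => momentProfile_le_flux_div_mul hη hpos hR k hr) n

lemma bddAbove_momentRatio (hη : Continuous η) (hpos : ∀ r, 0 < η r) (hR : 0 < R) :
    BddAbove (Set.range (momentRatio d η R)) :=
  ⟨_, Set.forall_mem_range.2 (momentRatio_le_flux_div hη hpos hR 0)⟩

lemma momentRatio_le_radialEigenvalue (hη : Continuous η) (hpos : ∀ r, 0 < η r) (hR : 0 < R)
    (k : ℕ) : momentRatio d η R k ≤ radialEigenvalue d η R :=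
  le_ciSup (bddAbove_momentRatio hη hpos hR) k

lemma radialEigenvalue_le_flux_div (hη : Continuous η) (hpos : ∀ r, 0 < η r) (hR : 0 < R)
    (k : ℕ) : radialEigenvalue d η R ≤ radialFlux d η (momentProfile d η R k) R /
      radialFlux d η (momentProfile d η R (k + 1)) R :=
  ciSup_le (momentRatio_le_flux_div hη hpos hR k)

lemma radialGreen_sub (hη : Continuous η) (hpos : ∀ r, 0 < η r) (hg : Continuous g) (r s : ℝ) :
    radialGreen d η R g r - radialGreen d η R g s = ∫ x in r..s, x / η x ^ d * radialFlux d η g x := by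
  have hc := continuous_radialGreen_integrand (d := d) hη hpos hg
  rw [sub_eq_iff_eq_add]
  exact (intervalIntegral.integral_add_adjacent_intervals
    (hc.intervalIntegrable r s) (hc.intervalIntegrable s R)).symm

lemma radialGreen_sub_mono (hη : Continuous η) (hpos : ∀ r, 0 < η r) (hg : Continuous g)
    (hh : Continuous h) (hle : ∀ r ∈ Set.Icc 0 R, g r ≤ h r) {r s : ℝ} (hr : 0 ≤ r)
    (hrs : r ≤ s) (hs : s ≤ R) :
    radialGreen d η R g r - radialGreen d η R g s ≤
      radialGreen d η R h r - radialGreen d η R h s := by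
  rw [radialGreen_sub hη hpos hg, radialGreen_sub hη hpos hh]
  refine intervalIntegral.integral_mono_on hrs
    ((continuous_radialGreen_integrand hη hpos hg).intervalIntegrable _ _)
    ((continuous_radialGreen_integrand hη hpos hh).intervalIntegrable _ _) fun x hx => ?_
  have h0 : 0 ≤ x := hr.trans hx.1
  have := radialFlux_mono (d := d) hη hpos hg hh hle ⟨h0, hx.2.trans hs⟩
  have h1 := pow_pos (hpos x) d
  gcongr

/-! ### Passage to the limit and the radial eigenfunction -/

section Limits

open Filter Topology

variable {u : ℕ → ℝ → ℝ} {C : ℝ}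

lemma abs_radialFlux_le (hη : Continuous η) (hpos : ∀ r, 0 < η r) (hg : Continuous g)
    (hle : ∀ r ∈ Set.Icc 0 R, |g r| ≤ C) {s : ℝ} (hs : s ∈ Set.Icc 0 R) :
    |radialFlux d η g s| ≤ radialFlux d η (fun _ => C) s := by
  refine abs_le.2 ⟨?_, radialFlux_mono hη hpos hg continuous_const
    (fun r hr => (abs_le.1 (hle r hr)).2) hs⟩
  have := radialFlux_mono (d := d) hη hpos (continuous_const (y := -1 * C)) hg
    (fun r hr => by simpa using (abs_le.1 (hle r hr)).1) hs
  rwa [radialFlux_const_mul (g := fun _ => C), neg_one_mul] at this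

lemma tendsto_radialFlux (hη : Continuous η) (hpos : ∀ r, 0 < η r) (hu : ∀ k, Continuous (u k))
    (hle : ∀ k, ∀ r ∈ Set.Icc 0 R, |u k r| ≤ C)
    (hlim : ∀ r ∈ Set.Icc 0 R, Tendsto (fun k => u k r) atTop (𝓝 (g r))) {s : ℝ}
    (hs : s ∈ Set.Icc 0 R) :
    Tendsto (fun k => radialFlux d η (u k) s) atTop (𝓝 (radialFlux d η g s)) := by
  have hmem : ∀ t ∈ Set.uIoc (0 : ℝ) 1, 0 ≤ t ∧ s * t ∈ Set.Icc 0 R := fun t ht => by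
    rw [Set.uIoc_of_le zero_le_one] at ht
    exact ⟨ht.1.le, mul_nonneg hs.1 ht.1.le, (mul_le_of_le_one_right hs.1 ht.2).trans hs.2⟩
  refine intervalIntegral.tendsto_integral_filter_of_dominated_convergence
    (fun t => t ^ d * η (s * t) ^ d * C) (Eventually.of_forall fun k => ?_)
    (Eventually.of_forall fun k => Eventually.of_forall fun t ht => ?_)
    (Continuous.intervalIntegrable (by fun_prop) _ _)
    (Eventually.of_forall fun t ht => (hlim _ (hmem t ht).2).const_mul _)
  · have := hu k
    exact Continuous.aestronglyMeasurable (by fun_prop)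
  · have h1 := pow_nonneg (hpos (s * t)).le d
    have h2 := pow_nonneg (hmem t ht).1 d
    rw [Real.norm_eq_abs, abs_mul, abs_of_nonneg (mul_nonneg h2 h1)]
    exact mul_le_mul_of_nonneg_left (hle k _ (hmem t ht).2) (mul_nonneg h2 h1)

lemma tendsto_radialGreen (hη : Continuous η) (hpos : ∀ r, 0 < η r) (hu : ∀ k, Continuous (u k))
    (hle : ∀ k, ∀ r ∈ Set.Icc 0 R, |u k r| ≤ C)
    (hlim : ∀ r ∈ Set.Icc 0 R, Tendsto (fun k => u k r) atTop (𝓝 (g r))) {r : ℝ}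
    (hr : r ∈ Set.Icc 0 R) :
    Tendsto (fun k => radialGreen d η R (u k) r) atTop (𝓝 (radialGreen d η R g r)) := by
  have hmem : ∀ t ∈ Set.uIoc r R, t ∈ Set.Icc 0 R := fun t ht => by
    rw [Set.uIoc_of_le hr.2] at ht
    exact ⟨hr.1.trans ht.1.le, ht.2⟩
  refine intervalIntegral.tendsto_integral_filter_of_dominated_convergence
    (fun s => s / η s ^ d * radialFlux d η (fun _ => C) s) (Eventually.of_forall fun k => ?_)
    (Eventually.of_forall fun k => Eventually.of_forall fun t ht => ?_)
    ((continuous_radialGreen_integrand hη hpos continuous_const).intervalIntegrable _ _)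
    (Eventually.of_forall fun t ht =>
      (tendsto_radialFlux hη hpos hu hle hlim (hmem t ht)).const_mul _)
  · exact (continuous_radialGreen_integrand hη hpos (hu k)).aestronglyMeasurable
  · have h1 := div_nonneg (hmem t ht).1 (pow_nonneg (hpos t).le d)
    rw [Real.norm_eq_abs, abs_mul, abs_of_nonneg h1]
    exact mul_le_mul_of_nonneg_left (abs_radialFlux_le hη hpos (hu k) (hle k) (hmem t ht)) h1

/-- The normalised profiles v_k satisfy v_{k+1} = c_k G v_k with c_k → λ, and they decrease in k
because c_k is the minimum of G_k/G_{k+1}. As 0 ≤ v_k ≤ 1, their oscillation is controlled by that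
of G 1, so the pointwise limit is continuous; dominated convergence gives its equation. -/
lemma exists_radial_eigenfunction (hη : Continuous η) (hpos : ∀ r, 0 < η r) (hR : 0 < R) :
    ∃ f : ℝ → ℝ, Continuous f ∧ f 0 = 1 ∧
      ∀ r ∈ Set.Icc 0 R, f r = radialEigenvalue d η R * radialGreen d η R f r := by
  have hc := continuous_momentProfile (d := d) (R := R) hη hpos
  have h0 : (0 : ℝ) ∈ Set.Icc 0 R := ⟨le_rfl, hR.le⟩
  set G := momentProfile d η R with hG
  set c := momentRatio d η R with hcdef
  set lam := radialEigenvalue d η R with hlam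
  have hGpos : ∀ k, 0 < G k 0 := fun k => momentProfile_pos hη hpos hR k 0 ⟨le_rfl, hR⟩
  have hclam : Tendsto c atTop (𝓝 lam) :=
    tendsto_atTop_ciSup (monotone_momentRatio hη hpos hR) (bddAbove_momentRatio hη hpos hR)
  let v : ℕ → ℝ → ℝ := fun k r => (G k 0)⁻¹ * G k r
  have hvc : ∀ k, Continuous (v k) := fun k => (hc k).const_mul _
  have hv0 : ∀ k, v k 0 = 1 := fun k => inv_mul_cancel₀ (hGpos k).ne'
  have hvnn : ∀ k, ∀ r ∈ Set.Icc 0 R, 0 ≤ v k r := fun k r hr =>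
    mul_nonneg (inv_nonneg.2 (hGpos k).le) (momentProfile_nonneg hη hpos hR k r hr)
  have hvanti : ∀ r ∈ Set.Icc 0 R, Antitone fun k => v k r := by
    intro r hr
    refine antitone_nat_of_succ_le fun k => ?_
    have := momentRatio_mul_le (d := d) hη hpos hR k hr
    have h1 := hGpos k
    have h2 := hGpos (k + 1)
    simp only [momentRatio, ← hG] at this
    simp only [v]
    rw [div_mul_eq_mul_div, div_le_iff₀ h2] at this
    rw [inv_mul_eq_div, inv_mul_eq_div, div_le_div_iff₀ h2 h1]
    linarith
  have hvrec : ∀ k r, v (k + 1) r = c k * radialGreen d η R (v k) r := by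
    intro k r
    simp only [v, radialGreen_const_mul]
    have h1 := (hGpos k).ne'
    have h2 := (hGpos (k + 1)).ne'
    change _ = G k 0 / G (k + 1) 0 * (_ * G (k + 1) r)
    field_simp
  have hvle : ∀ k, ∀ r ∈ Set.Icc 0 R, |v k r| ≤ 1 := by
    intro k r hr
    rw [abs_of_nonneg (hvnn k r hr)]
    have := hvanti r hr (Nat.zero_le k)
    simpa [v, hG, momentProfile] using this
  let F : ℝ → ℝ := fun r => ⨅ k, v k r
  have hlim : ∀ r ∈ Set.Icc 0 R, Tendsto (fun k => v k r) atTop (𝓝 (F r)) := fun r hr =>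
    tendsto_atTop_ciInf (hvanti r hr) ⟨0, Set.forall_mem_range.2 fun k => hvnn k r hr⟩
  have hvlip : ∀ k, ∀ r ∈ Set.Icc 0 R, ∀ s ∈ Set.Icc 0 R, r ≤ s →
      |v (k + 1) r - v (k + 1) s| ≤ lam * |G 1 r - G 1 s| := by
    intro k r hr s hs hrs
    have hck : 0 < c k := momentRatio_pos hη hpos hR k
    have hub := radialGreen_sub_mono (d := d) hη hpos (hvc k) (continuous_const (y := 1))
      (fun x hx => (le_abs_self _).trans (hvle k x hx)) hr.1 hrs hs.2
    -- The zero function is written 0 * 1 so that `radialGreen_const_mul` evaluates its Green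
    -- integral.
    have hlb := radialGreen_sub_mono (d := d) hη hpos (continuous_const (y := 0 * 1)) (hvc k)
      (fun x hx => by simpa using hvnn k x hx) hr.1 hrs hs.2
    rw [radialGreen_const_mul (g := fun _ => 1), radialGreen_const_mul (g := fun _ => 1)] at hlb
    change _ ≤ G 1 r - G 1 s at hub
    rw [hvrec, hvrec, ← mul_sub, abs_mul, abs_of_pos hck]
    refine mul_le_mul (momentRatio_le_radialEigenvalue hη hpos hR k) ?_ (abs_nonneg _)
      (hck.le.trans (momentRatio_le_radialEigenvalue hη hpos hR k))
    rw [abs_of_nonneg (by linarith)]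
    exact hub.trans (le_abs_self _)
  have hFlip' : ∀ r ∈ Set.Icc 0 R, ∀ s ∈ Set.Icc 0 R, r ≤ s →
      |F r - F s| ≤ lam * |G 1 r - G 1 s| := fun r hr s hs hrs =>
    le_of_tendsto ((((tendsto_add_atTop_iff_nat 1).2 (hlim r hr)).sub
      ((tendsto_add_atTop_iff_nat 1).2 (hlim s hs))).abs)
      (Eventually.of_forall fun k => hvlip k r hr s hs hrs)
  have hFlip : ∀ r ∈ Set.Icc 0 R, ∀ s ∈ Set.Icc 0 R, |F r - F s| ≤ lam * |G 1 r - G 1 s| := by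
    intro r hr s hs
    rcases le_total r s with hrs | hrs
    · exact hFlip' r hr s hs hrs
    · rw [abs_sub_comm, abs_sub_comm (G 1 r)]
      exact hFlip' s hs r hr hrs
  -- The limit is controlled only on [0, R]; composing with the retraction p makes it continuous on
  -- the whole line.
  let p : ℝ → ℝ := fun r => max 0 (min R r)
  have hp : Continuous p := by fun_prop
  have hpmem : ∀ r, p r ∈ Set.Icc 0 R := fun r => ⟨le_max_left _ _, max_le hR.le (min_le_left _ _)⟩
  have hpid : ∀ r ∈ Set.Icc 0 R, p r = r := fun r hr => by
    simp only [p]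
    rw [min_eq_right hr.2, max_eq_right hr.1]
  refine ⟨fun r => F (p r), continuous_iff_continuousAt.2 fun r => ?_, ?_, fun r hr => ?_⟩
  · refine tendsto_iff_dist_tendsto_zero.2 ?_
    have h1 : Tendsto (fun s => lam * |G 1 (p s) - G 1 (p r)|) (𝓝 r) (𝓝 0) := by
      have : Continuous fun s => lam * |G 1 (p s) - G 1 (p r)| := by
        have := hc 1
        fun_prop
      simpa using this.tendsto r
    exact squeeze_zero (fun _ => dist_nonneg) (fun s => hFlip _ (hpmem s) _ (hpmem r)) h1
  · simp only
    rw [hpid 0 h0]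
    simp [F, hv0]
  · have h1 := tendsto_radialGreen (d := d) hη hpos hvc hvle (g := fun r => F (p r))
      (fun s hs => by simpa only [hpid s hs] using hlim s hs) hr
    have h2 := (tendsto_add_atTop_iff_nat 1).2 (hlim r hr)
    simp only [hpid r hr]
    refine tendsto_nhds_unique h2 ?_
    simp only [hvrec]
    exact hclam.mul h1

end Limits

end

end WarpedModel

namespace WarpedModel

noncomputable section

/-! ### The metric of the model space -/

/-- `η` is a positive continuous extension of `w(r) / r`, `r ∈ [0, R]`, and `θ(r) = r η'(r)`. -/
structure IsProfile (w : ℝ → ℝ) (R : ℝ) (η θ : ℝ → ℝ) : Prop where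
  continuous : Continuous η
  pos : ∀ r, 0 < η r
  map_zero : η 0 = 1
  eq_mul : ∀ r ∈ Set.Icc 0 R, w r = r * η r
  hasDerivAt_zero : HasDerivAt η 0 0
  hasDerivAt : ∀ r ∈ Set.Ioo 0 R, HasDerivAt η (θ r / r) r
  continuousOn : ContinuousOn θ (Set.Ico 0 R)
  zero : θ 0 = 0

/-- The projection `θ θᵀ` onto the radial direction at `x = r θ`. -/
def radialProj {m : ℕ} (x : Coord m) : Matrix (Fin m) (Fin m) ℝ :=
  Matrix.vecMulVec (‖x‖⁻¹ • x).ofLp (‖x‖⁻¹ • x).ofLp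

variable {m : ℕ} {w η θ : ℝ → ℝ} {R : ℝ} {x : Coord m}

lemma dotProduct_self_eq_norm_sq (x : Coord m) : x.ofLp ⬝ᵥ x.ofLp = ‖x‖ ^ 2 := by
  rw [EuclideanSpace.norm_sq_eq]
  simp [dotProduct, sq]

lemma radialProj_apply (i j : Fin m) : radialProj x i j = ‖x‖⁻¹ * x i * (‖x‖⁻¹ * x j) := by
  simp [radialProj, Matrix.vecMulVec_apply]

@[simp] lemma radialProj_zero : radialProj (0 : Coord m) = 0 := by
  ext i j
  simp [radialProj_apply]

lemma radialProj_mulVec_self : (radialProj x).mulVec x.ofLp = x.ofLp := by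
  rcases eq_or_ne x 0 with rfl | hx
  · simp
  have h := norm_ne_zero_iff.2 hx
  ext i
  have h1 : ∑ j, x j * x j = ‖x‖ ^ 2 := dotProduct_self_eq_norm_sq x
  calc ∑ j, radialProj x i j * x j = ‖x‖⁻¹ * x i * ‖x‖⁻¹ * ∑ j, x j * x j := by
        rw [Finset.mul_sum]
        refine Finset.sum_congr rfl fun j _ => ?_
        rw [radialProj_apply]
        ring
    _ = x i := by
        rw [h1]
        field_simp

lemma radialProj_mul_self : radialProj x * radialProj x = radialProj x := by
  have h : radialProj x * radialProj x =
      Matrix.vecMulVec ((radialProj x).mulVec (‖x‖⁻¹ • x).ofLp) (‖x‖⁻¹ • x).ofLp := by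
    conv_lhs => rw [radialProj.eq_1 (x := x)]
    rw [← Matrix.mul_vecMulVec]
    rfl
  rw [h, WithLp.ofLp_smul, Matrix.mulVec_smul, radialProj_mulVec_self]
  rfl

lemma radialProj_transpose : (radialProj x).transpose = radialProj x :=
  Matrix.transpose_vecMulVec _ _

lemma radialProj_add_mul (a b : ℝ) :
    (radialProj x + a • (1 - radialProj x)) * (radialProj x + b • (1 - radialProj x)) =
      radialProj x + (a * b) • (1 - radialProj x) := by
  have h := radialProj_mul_self (x := x)
  simp only [mul_add, add_mul, smul_mul_assoc, mul_smul_comm, mul_sub, sub_mul, mul_one, one_mul, h]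
  module

lemma radialProj_add_inv {c : ℝ} (hc : c ≠ 0) :
    (radialProj x + c • (1 - radialProj x))⁻¹ = radialProj x + c⁻¹ • (1 - radialProj x) := by
  apply Matrix.inv_eq_right_inv
  rw [radialProj_add_mul, mul_inv_cancel₀ hc, one_smul, add_sub_cancel]

/-- Eigenvalue 1 on the radial line and c on its complement, computed by the rank-one determinant
formula. At x = 0 the projection is 0 and the determinant would be c^m. -/
lemma det_radialProj_add {c : ℝ} (hc : c ≠ 0) (hx : x ≠ 0) :
    (radialProj x + c • (1 - radialProj x)).det = c ^ (m - 1) := by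
  have hm : m ≠ 0 := by
    rintro rfl
    exact hx (Subsingleton.elim _ _)
  obtain ⟨n, rfl⟩ := Nat.exists_eq_succ_of_ne_zero hm
  have h := norm_ne_zero_iff.2 hx
  have e : radialProj x + c • (1 - radialProj x) = c • (1 +
      Matrix.replicateCol Unit (((1 - c) / c) • (‖x‖⁻¹ • x).ofLp) *
        Matrix.replicateRow Unit (‖x‖⁻¹ • x).ofLp) := by
    rw [← Matrix.vecMulVec_eq, Matrix.smul_vecMulVec, smul_add, smul_smul, mul_div_cancel₀ _ hc]
    change _ = _ + _ • radialProj x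
    module
  rw [e, Matrix.det_smul, Matrix.det_one_add_replicateCol_mul_replicateRow, dotProduct_smul,
    dotProduct_self_eq_norm_sq, norm_smul, norm_inv, norm_norm, inv_mul_cancel₀ h]
  simp only [Fintype.card_fin, Nat.succ_eq_add_one, Nat.add_sub_cancel, smul_eq_mul]
  field_simp
  ring

/-- One formula covers the center as well, because there the projection is 0 and η = 1. -/
lemma IsProfile.modelMetric_eq (hη : IsProfile w R η θ) (hx : ‖x‖ ≤ R) :
    modelMetric m w x = radialProj x + (η ‖x‖ ^ 2) • (1 - radialProj x) := by
  rcases eq_or_ne x 0 with rfl | h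
  · simp [modelMetric, hη.map_zero]
  · rw [modelMetric, if_neg h, hη.eq_mul _ ⟨norm_nonneg x, hx⟩, smul_smul]
    have := norm_ne_zero_iff.2 h
    congr 2
    field_simp

lemma IsProfile.volumeDensity_eq (hη : IsProfile w R η θ) (hx : ‖x‖ ≤ R) :
    volumeDensity (modelMetric m w) x = η ‖x‖ ^ (m - 1) := by
  rw [volumeDensity, hη.modelMetric_eq hx]
  rcases eq_or_ne x 0 with rfl | h
  · simp [hη.map_zero]
  · have := hη.pos ‖x‖
    rw [det_radialProj_add (by positivity) h, ← pow_mul, mul_comm 2, pow_mul,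
      Real.sqrt_sq (by positivity)]

lemma IsProfile.modelMetric_inv (hη : IsProfile w R η θ) (hx : ‖x‖ ≤ R) :
    (modelMetric m w x)⁻¹ = radialProj x + ((η ‖x‖)⁻¹ ^ 2) • (1 - radialProj x) := by
  have := hη.pos ‖x‖
  rw [hη.modelMetric_eq hx, radialProj_add_inv (by positivity), inv_pow]

/-! ### The Laplace-Beltrami operator of a general metric -/

section LaplaceBeltrami

open Filter Topology

variable {g : Coord m → Matrix (Fin m) (Fin m) ℝ} {z z₁ z₂ : Coord m → ℝ}

/-- The coefficients `(det g)^{1/2} g^{ij}` of the Laplace-Beltrami operator. -/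
def laplaceCoeff (g : Coord m → Matrix (Fin m) (Fin m) ℝ) (i j : Fin m) (x : Coord m) : ℝ :=
  volumeDensity g x * (g x)⁻¹ i j

lemma partialDeriv_congr {i : Fin m} (h : z₁ =ᶠ[𝓝 x] z₂) :
    partialDeriv i z₁ x = partialDeriv i z₂ x := by
  rw [partialDeriv, partialDeriv, h.fderiv_eq]

lemma laplaceBeltrami_eq_div (z : Coord m → ℝ) (x : Coord m) :
    laplaceBeltrami g z x = (volumeDensity g x)⁻¹ *
      ∑ i, partialDeriv i (fun y => ∑ j, laplaceCoeff g i j y * partialDeriv j z y) x := by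
  simp only [laplaceBeltrami, laplaceCoeff, Finset.mul_sum, mul_assoc]

lemma differentiableAt_partialDeriv (hz : ContDiffAt ℝ 2 z x) (j : Fin m) :
    DifferentiableAt ℝ (partialDeriv j z) x := by
  have h1 : DifferentiableAt ℝ (fderiv ℝ z) x :=
    (hz.fderiv_right (m := 1) le_rfl).differentiableAt one_ne_zero
  exact h1.clm_apply (differentiableAt_const _)

lemma partialDeriv_partialDeriv (hz : ContDiffAt ℝ 2 z x) (i j : Fin m) :
    partialDeriv i (partialDeriv j z) x = fderiv ℝ (fderiv ℝ z) x (EuclideanSpace.single i 1)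
      (EuclideanSpace.single j 1) := by
  have h1 : DifferentiableAt ℝ (fderiv ℝ z) x :=
    (hz.fderiv_right (m := 1) le_rfl).differentiableAt one_ne_zero
  have h2 := (h1.hasFDerivAt.clm_apply (hasFDerivAt_const (EuclideanSpace.single j (1 : ℝ)) x)).fderiv
  change fderiv ℝ (fun y => fderiv ℝ z y (EuclideanSpace.single j 1)) x _ = _
  rw [h2]
  simp

lemma laplaceBeltrami_eq_sum (hA : ∀ i j, DifferentiableAt ℝ (laplaceCoeff g i j) x)
    (hz : ContDiffAt ℝ 2 z x) :
    laplaceBeltrami g z x = (volumeDensity g x)⁻¹ * ∑ i, ∑ j,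
      (laplaceCoeff g i j x * partialDeriv i (partialDeriv j z) x +
        partialDeriv j z x * partialDeriv i (laplaceCoeff g i j) x) := by
  rw [laplaceBeltrami_eq_div]
  congr 1
  refine Finset.sum_congr rfl fun i _ => ?_
  have h1 : ∀ j, DifferentiableAt ℝ (fun y => laplaceCoeff g i j y * partialDeriv j z y) x :=
    fun j => (hA i j).mul (differentiableAt_partialDeriv hz j)
  rw [partialDeriv, fderiv_fun_sum fun j _ => h1 j, _root_.sum_apply]
  refine Finset.sum_congr rfl fun j _ => ?_
  rw [fderiv_fun_mul (hA i j) (differentiableAt_partialDeriv hz j)]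
  rfl

lemma partialDeriv_linear (c₁ c₂ : ℝ) (i : Fin m) (h₁ : DifferentiableAt ℝ z₁ x)
    (h₂ : DifferentiableAt ℝ z₂ x) :
    partialDeriv i (fun y => c₁ * z₁ y + c₂ * z₂ y) x =
      c₁ * partialDeriv i z₁ x + c₂ * partialDeriv i z₂ x := by
  rw [partialDeriv, fderiv_fun_add (h₁.const_mul _) (h₂.const_mul _), fderiv_const_mul h₁,
    fderiv_const_mul h₂]
  rfl

lemma laplaceBeltrami_linear (hA : ∀ i j, DifferentiableAt ℝ (laplaceCoeff g i j) x)
    (h₁ : ContDiffAt ℝ 2 z₁ x) (h₂ : ContDiffAt ℝ 2 z₂ x) (c₁ c₂ : ℝ) :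
    laplaceBeltrami g (fun y => c₁ * z₁ y + c₂ * z₂ y) x =
      c₁ * laplaceBeltrami g z₁ x + c₂ * laplaceBeltrami g z₂ x := by
  have hev : ∀ {z : Coord m → ℝ}, ContDiffAt ℝ 2 z x → ∀ᶠ y in 𝓝 x, DifferentiableAt ℝ z y :=
    fun h => (h.eventually (by simp)).mono fun y hy => hy.differentiableAt two_ne_zero
  have e1 : ∀ j, partialDeriv j (fun y => c₁ * z₁ y + c₂ * z₂ y) =ᶠ[𝓝 x]
      fun y => c₁ * partialDeriv j z₁ y + c₂ * partialDeriv j z₂ y := fun j => by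
    filter_upwards [hev h₁, hev h₂] with y hy₁ hy₂
    exact partialDeriv_linear _ _ _ hy₁ hy₂
  have e2 : ∀ i j, partialDeriv i (partialDeriv j fun y => c₁ * z₁ y + c₂ * z₂ y) x =
      c₁ * partialDeriv i (partialDeriv j z₁) x + c₂ * partialDeriv i (partialDeriv j z₂) x :=
    fun i j => by
      rw [partialDeriv_congr (e1 j), partialDeriv_linear _ _ _ (differentiableAt_partialDeriv h₁ j)
        (differentiableAt_partialDeriv h₂ j)]
  rw [laplaceBeltrami_eq_sum hA ((contDiffAt_const.mul h₁).add (contDiffAt_const.mul h₂)),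
    laplaceBeltrami_eq_sum hA h₁, laplaceBeltrami_eq_sum hA h₂]
  simp only [e2, (e1 _).self_of_nhds, Finset.mul_sum, ← Finset.sum_add_distrib]
  refine Finset.sum_congr rfl fun i _ => Finset.sum_congr rfl fun j _ => ?_
  ring

/-- Restrict to a line. A negative second derivative would make the minimum also a local maximum, so
the restriction would be locally constant and its second derivative 0. -/
lemma fderiv_fderiv_nonneg_of_isLocalMin {E : Type*} [NormedAddCommGroup E] [NormedSpace ℝ E]
    {z : E → ℝ} {x : E} (hz : ContDiffAt ℝ 2 z x) (hmin : IsLocalMin z x) (v : E) :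
    0 ≤ fderiv ℝ (fderiv ℝ z) x v v := by
  have hline : ∀ t : ℝ, HasDerivAt (fun t : ℝ => x + t • v) v t := fun t => by
    simpa using ((hasDerivAt_id t).smul_const v).const_add x
  have hx0 : x + (0 : ℝ) • v = x := by simp
  have hcont : ContinuousAt (fun t : ℝ => x + t • v) 0 := (hline 0).continuousAt
  have htend : Tendsto (fun t : ℝ => x + t • v) (𝓝 0) (𝓝 x) := by
    simpa only [ContinuousAt, hx0] using hcont
  set φ : ℝ → ℝ := fun t => z (x + t • v) with hφ
  have hd1 : deriv φ =ᶠ[𝓝 0] fun t => fderiv ℝ z (x + t • v) v := by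
    have h1 : ∀ᶠ y in 𝓝 x, DifferentiableAt ℝ z y :=
      (hz.eventually (by simp)).mono fun y hy => hy.differentiableAt two_ne_zero
    filter_upwards [htend.eventually h1] with t ht
    exact (ht.hasFDerivAt.comp_hasDerivAt t (hline t)).deriv
  have hd2 : deriv (deriv φ) 0 = fderiv ℝ (fderiv ℝ z) x v v := by
    rw [hd1.deriv_eq]
    have h1 : DifferentiableAt ℝ (fderiv ℝ z) (x + (0 : ℝ) • v) := by
      rw [hx0]
      exact (hz.fderiv_right (m := 1) le_rfl).differentiableAt one_ne_zero
    have h2 := ((ContinuousLinearMap.apply ℝ ℝ v).hasFDerivAt.comp (x + (0 : ℝ) • v)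
      h1.hasFDerivAt).comp_hasDerivAt (0 : ℝ) (hline 0)
    rw [hx0] at h2
    exact h2.deriv
  have hmin0 : IsLocalMin φ 0 := by
    have := htend.eventually hmin
    simpa only [IsLocalMin, IsMinFilter, hφ, hx0] using this
  by_contra! hneg
  have hφc : ContinuousAt φ 0 := ContinuousAt.comp (by rw [hx0]; exact hz.continuousAt) hcont
  have hmax := isLocalMax_of_deriv_deriv_neg (hd2 ▸ hneg) hmin0.deriv_eq_zero hφc
  have hconst : φ =ᶠ[𝓝 0] fun _ => φ 0 := by
    filter_upwards [hmin0, hmax] with t h1 h2 using le_antisymm h2 h1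
  have h3 : deriv φ =ᶠ[𝓝 0] fun _ => 0 := by
    filter_upwards [hconst.eventuallyEq_nhds] with t ht
    rw [ht.deriv_eq, deriv_const]
  rw [← hd2, h3.deriv_eq, deriv_const] at hneg
  exact lt_irrefl _ hneg

/-- First-order terms vanish, and with coefficient matrix B Bᵀ the second-order part is the sum of
the Hessian's values on the columns of B. -/
lemma laplaceBeltrami_nonneg_of_isLocalMin
    (hA : ∀ i j, DifferentiableAt ℝ (laplaceCoeff g i j) x)
    {B : Matrix (Fin m) (Fin m) ℝ} (hB : ∀ i j, laplaceCoeff g i j x = (B * B.transpose) i j)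
    (hz : ContDiffAt ℝ 2 z x) (hmin : IsLocalMin z x) : 0 ≤ laplaceBeltrami g z x := by
  rw [laplaceBeltrami_eq_sum hA hz]
  refine mul_nonneg (inv_nonneg.2 (Real.sqrt_nonneg _)) ?_
  have h0 : ∀ j, partialDeriv j z x = 0 := fun j => by
    rw [partialDeriv, hmin.fderiv_eq_zero]
    rfl
  have key : ∑ i, ∑ j, (laplaceCoeff g i j x * partialDeriv i (partialDeriv j z) x +
      partialDeriv j z x * partialDeriv i (laplaceCoeff g i j) x) =
      ∑ k, fderiv ℝ (fderiv ℝ z) x (∑ i, B i k • EuclideanSpace.single i 1)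
        (∑ i, B i k • EuclideanSpace.single i 1) := by
    simp only [h0, zero_mul, add_zero, hB, Matrix.mul_apply, Matrix.transpose_apply,
      partialDeriv_partialDeriv hz, map_sum, map_smul, _root_.sum_apply,
      _root_.smul_apply, smul_eq_mul, Finset.sum_mul, Finset.mul_sum]
    rw [Finset.sum_comm' (t' := Finset.univ) (s' := fun _ => Finset.univ) (by simp)]
    conv_rhs => rw [Finset.sum_comm]
    refine Finset.sum_congr rfl fun i _ => ?_
    rw [Finset.sum_comm]
    refine Finset.sum_congr rfl fun j _ => Finset.sum_congr rfl fun k _ => ?_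
    ring
  rw [key]
  exact Finset.sum_nonneg fun k _ => fderiv_fderiv_nonneg_of_isLocalMin hz hmin _

end LaplaceBeltrami

end

end WarpedModel

namespace WarpedModel

noncomputable section

/-! ### Radial functions -/

section Radial

open Filter Topology Asymptotics

lemma hasFDerivAt_norm_of_ne_zero {E : Type*} [NormedAddCommGroup E] [InnerProductSpace ℝ E]
    {x : E} (hx : x ≠ 0) : HasFDerivAt (fun y : E => ‖y‖) (‖x‖⁻¹ • innerSL ℝ x) x := by
  have hn := norm_ne_zero_iff.2 hx
  have h := (hasStrictFDerivAt_norm_sq x).hasFDerivAt.sqrt (pow_ne_zero 2 hn)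
  simp only [Real.sqrt_sq (norm_nonneg _)] at h
  refine h.congr_fderiv ?_
  ext v
  simp
  field_simp

lemma hasFDerivAt_comp_norm_of_ne_zero {E : Type*} [NormedAddCommGroup E] [InnerProductSpace ℝ E]
    {φ : ℝ → ℝ} {φ' : ℝ} {x : E} (hx : x ≠ 0) (hφ : HasDerivAt φ φ' ‖x‖) :
    HasFDerivAt (fun y : E => φ ‖y‖) ((φ' / ‖x‖) • innerSL ℝ x) x := by
  have := hφ.comp_hasFDerivAt x (hasFDerivAt_norm_of_ne_zero hx)
  rwa [smul_smul, ← div_eq_mul_inv] at this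

lemma hasFDerivAt_comp_norm_zero {E : Type*} [NormedAddCommGroup E] [NormedSpace ℝ E]
    {φ : ℝ → ℝ} (hφ : HasDerivAt φ 0 0) :
    HasFDerivAt (fun y : E => φ ‖y‖) (0 : E →L[ℝ] ℝ) 0 := by
  rw [hasDerivAt_iff_isLittleO_nhds_zero] at hφ
  rw [hasFDerivAt_iff_isLittleO_nhds_zero]
  have h := hφ.comp_tendsto (tendsto_norm_zero (E := E))
  refine (h.congr_left fun y => ?_).trans_isBigO (isBigO_refl _ _).norm_left
  simp

/-- The zero of f absorbs the increments of c, so continuity of c is enough. This serves products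
such as κ(‖x‖) x_i at the center. -/
lemma hasFDerivAt_mul_of_eq_zero {E : Type*} [NormedAddCommGroup E] [NormedSpace ℝ E]
    {c f : E → ℝ} {f' : E →L[ℝ] ℝ} {x : E} (hc : ContinuousAt c x) (hf : HasFDerivAt f f' x)
    (h0 : f x = 0) : HasFDerivAt (fun y => c y * f y) (c x • f') x := by
  have h1 : (fun y => c y * (f y - f x - f' (y - x))) =o[𝓝 x] fun y => y - x := by
    simpa using hc.tendsto.isBigO_one ℝ |>.mul_isLittleO
      (hasFDerivAt_iff_isLittleO.1 hf).norm_right |>.norm_right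
  have h2 : (fun y => (c y - c x) * f' (y - x)) =o[𝓝 x] fun y => y - x := by
    have h3 : (fun y => c y - c x) =o[𝓝 x] fun _ => (1 : ℝ) :=
      (isLittleO_one_iff ℝ).2 (tendsto_sub_nhds_zero_iff.2 hc)
    simpa using (h3.mul_isBigO (f'.isBigO_sub (𝓝 x) x).norm_right).norm_right
  refine hasFDerivAt_iff_isLittleO.2 ((h1.add h2).congr_left fun y => ?_)
  simp only [h0, _root_.smul_apply, smul_eq_mul]
  ring

/-- Meant for c an entry of the radial projection, which is bounded but in general discontinuous at
the center. -/
lemma hasFDerivAt_mul_bounded_zero {E : Type*} [NormedAddCommGroup E] [NormedSpace ℝ E]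
    {c f : E → ℝ} {C : ℝ} {x : E} (hc : ∀ y, |c y| ≤ C) (hf : HasFDerivAt f (0 : E →L[ℝ] ℝ) x)
    (h0 : f x = 0) : HasFDerivAt (fun y => f y * c y) (0 : E →L[ℝ] ℝ) x := by
  have h1 : c =O[𝓝 x] fun _ => (1 : ℝ) := IsBigO.of_bound C (Eventually.of_forall fun y => by
    simpa using hc y)
  have h2 := (hasFDerivAt_iff_isLittleO.1 hf).norm_right.mul_isBigO h1
  refine hasFDerivAt_iff_isLittleO.2 (IsLittleO.of_norm_right ?_)
  simpa [h0] using h2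

lemma contDiffOn_two_of_hasFDerivAt {E : Type*} [NormedAddCommGroup E] [NormedSpace ℝ E]
    [FiniteDimensional ℝ E] {D : Set E} (hD : IsOpen D) {z : E → ℝ} {G : E → E →L[ℝ] ℝ}
    {H : E → E → E →L[ℝ] ℝ} (hz : ∀ x ∈ D, HasFDerivAt z (G x) x)
    (hG : ∀ v, ∀ x ∈ D, HasFDerivAt (fun y => G y v) (H v x) x)
    (hH : ∀ v u, ContinuousOn (fun x => H v x u) D) : ContDiffOn ℝ 2 z D := by
  have aux : ∀ {n : ℕ} {f : E → ℝ} {F : E → E →L[ℝ] ℝ}, (∀ x ∈ D, HasFDerivAt f (F x) x) →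
      (∀ v, ContDiffOn ℝ n (fun x => F x v) D) → ContDiffOn ℝ ((n : ℕ∞ω) + 1) f D := by
    intro n f F hf hF
    refine (contDiffOn_succ_iff_fderiv_apply hD.uniqueDiffOn).2
      ⟨fun x hx => (hf x hx).differentiableAt.differentiableWithinAt, by simp, fun v => ?_⟩
    refine (hF v).congr fun x hx => ?_
    rw [fderivWithin_of_isOpen hD hx, (hf x hx).fderiv]
  have h1 : ContDiffOn ℝ (((1 : ℕ) : ℕ∞ω) + 1) z D := by
    refine aux hz fun v => ?_
    have h2 : ContDiffOn ℝ (((0 : ℕ) : ℕ∞ω) + 1) (fun x => G x v) D :=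
      aux (hG v) fun u => by simpa using hH v u
    simpa using h2
  have h3 : (((1 : ℕ) : ℕ∞ω) + 1) = 2 := by norm_num
  rwa [h3] at h1

/-- The gradient is κ(‖x‖) x and the Hessian κ I + μ ‖x‖⁻² x ⊗ x. By Cauchy-Schwarz the last term is
at most |μ(‖x‖)| in norm, so μ(0) = 0 makes the Hessian continuous at the center. -/
lemma contDiffOn_comp_norm {E : Type*} [NormedAddCommGroup E] [InnerProductSpace ℝ E]
    [FiniteDimensional ℝ E] {R : ℝ} {f κ μ : ℝ → ℝ} (hf : ∀ r, HasDerivAt f (r * κ r) r)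
    (hκ : ∀ r ∈ Set.Ioo 0 R, HasDerivAt κ (μ r / r) r) (hκc : Continuous κ)
    (hμ : ContinuousOn μ (Set.Ico 0 R)) (hμ0 : μ 0 = 0) :
    ContDiffOn ℝ 2 (fun x : E => f ‖x‖) (Metric.ball 0 R) := by
  refine contDiffOn_two_of_hasFDerivAt Metric.isOpen_ball (G := fun x => κ ‖x‖ • innerSL ℝ x)
    (H := fun v x => κ ‖x‖ • innerSL ℝ v + (inner ℝ x v * (μ ‖x‖ / ‖x‖ ^ 2)) • innerSL ℝ x)
    (fun x hx => ?_) (fun v x hx => ?_) (fun v u => ?_)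
  · rcases eq_or_ne x 0 with rfl | h
    · have := hf 0
      rw [zero_mul] at this
      simpa using hasFDerivAt_comp_norm_zero (E := E) this
    · have := hasFDerivAt_comp_norm_of_ne_zero h (hf ‖x‖)
      rwa [mul_div_cancel_left₀ _ (norm_ne_zero_iff.2 h)] at this
  · have hin : HasFDerivAt (fun y : E => inner ℝ y v) (innerSL ℝ v) x := by
      have := (innerSL ℝ v).hasFDerivAt (x := x)
      refine this.congr_of_eventuallyEq (Eventually.of_forall fun y => ?_)
      simp [real_inner_comm]
    have hfun : (fun y : E => (κ ‖y‖ • innerSL ℝ y) v) = fun y => κ ‖y‖ * inner ℝ y v := by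
      ext y
      simp
    rw [hfun]
    rcases eq_or_ne x 0 with rfl | h
    · have := hasFDerivAt_mul_of_eq_zero (c := fun y : E => κ ‖y‖)
        (hκc.comp continuous_norm).continuousAt hin (inner_zero_left _)
      simpa using this
    · have hn := norm_pos_iff.2 h
      have := (hasFDerivAt_comp_norm_of_ne_zero h (hκ ‖x‖ ⟨hn, by simpa using hx⟩)).mul hin
      rwa [smul_smul, div_div, ← sq] at this
  · have hmaps : Set.MapsTo (fun x : E => ‖x‖) (Metric.ball 0 R) (Set.Ico 0 R) := fun x hx =>
      ⟨norm_nonneg x, by simpa using hx⟩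
    have hμc : ContinuousOn (fun x : E => μ ‖x‖) (Metric.ball 0 R) :=
      hμ.comp continuous_norm.continuousOn hmaps
    have hfun : (fun x : E => (κ ‖x‖ • innerSL ℝ v +
        (inner ℝ x v * (μ ‖x‖ / ‖x‖ ^ 2)) • innerSL ℝ x) u) =
        fun x => κ ‖x‖ * inner ℝ v u + inner ℝ x v * (μ ‖x‖ / ‖x‖ ^ 2) * inner ℝ x u := by
      ext x
      simp
    rw [hfun]
    refine ContinuousOn.add (Continuous.continuousOn (by fun_prop)) fun x hx => ?_
    rcases eq_or_ne x 0 with rfl | h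
    · refine tendsto_iff_norm_sub_tendsto_zero.2 ?_
      have h1 : Tendsto (fun x : E => |μ ‖x‖| * (‖v‖ * ‖u‖)) (𝓝[Metric.ball 0 R] 0) (𝓝 0) := by
        have := ((hμc 0 hx).abs.mul_const (‖v‖ * ‖u‖))
        simpa [ContinuousWithinAt, hμ0] using this
      refine squeeze_zero (fun _ => norm_nonneg _) (fun y => ?_) h1
      simp only [inner_zero_left, zero_mul, sub_zero]
      rw [Real.norm_eq_abs, abs_mul, abs_mul, abs_div, abs_pow, abs_norm]
      rcases eq_or_ne y 0 with rfl | hy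
      · simp only [inner_zero_left, abs_zero, zero_mul, mul_zero]
        positivity
      have hn := norm_pos_iff.2 hy
      calc |inner ℝ y v| * (|μ ‖y‖| / ‖y‖ ^ 2) * |inner ℝ y u|
          ≤ ‖y‖ * ‖v‖ * (|μ ‖y‖| / ‖y‖ ^ 2) * (‖y‖ * ‖u‖) := by
            gcongr
            · exact abs_real_inner_le_norm y v
            · exact abs_real_inner_le_norm y u
        _ = |μ ‖y‖| * (‖v‖ * ‖u‖) := by field_simp
    · have hn := norm_ne_zero_iff.2 h
      have h1 : ContinuousWithinAt (fun x : E => μ ‖x‖ / ‖x‖ ^ 2) (Metric.ball 0 R) x :=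
        (hμc x hx).div (by fun_prop) (pow_ne_zero 2 hn)
      exact ((by fun_prop : ContinuousWithinAt (fun x : E => inner ℝ x v) _ x).mul h1).mul
        (by fun_prop)

end Radial

variable {m : ℕ} {w η θ g : ℝ → ℝ} {R : ℝ} {x : Coord m}

/-! ### The Laplacian of the model metric on radial functions -/

section Profile

open Filter Topology

lemma IsProfile.contDiffOn_radialGreen (hη : IsProfile w R η θ) (hg : Continuous g) (d : ℕ) :
    ContDiffOn ℝ 2 (fun x : Coord m => radialGreen d η R g ‖x‖) (Metric.ball 0 R) := by
  set T := radialFlux d η g with hT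
  have hTc : Continuous T := continuous_radialFlux hη.continuous hg
  have hηc := hη.continuous
  have hne : ∀ r, η r ^ d ≠ 0 := fun r => (pow_pos (hη.pos r) d).ne'
  -- Here κ is the derivative of the Green integral divided by r, and μ = r κ'. The equality μ(0) =
  -- 0 comes from T(0) = g(0)/(d + 1) and θ(0) = 0.
  refine contDiffOn_comp_norm (κ := fun r => -(T r / η r ^ d))
    (μ := fun r => -(((η r ^ d * g r - (d + 1) * T r) * η r ^ d -
      T r * (d * η r ^ (d - 1) * θ r)) / (η r ^ d) ^ 2)) (fun r => ?_) (fun r hr => ?_) ?_ ?_ ?_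
  · refine (hasDerivAt_radialGreen hη.continuous hη.pos hg r).congr_deriv ?_
    rw [← hT]
    ring
  · have h1 := (hasDerivAt_radialFlux (d := d) hη.continuous hg hr.1.ne').div
      ((hη.hasDerivAt r hr).pow d) (hne r)
    refine h1.neg.congr_deriv ?_
    have := hr.1.ne'
    simp only [Pi.pow_apply, ← hT]
    field_simp
  · exact (hTc.div (hηc.pow d) hne).neg
  · have h1 := hη.continuousOn
    refine ContinuousOn.neg (ContinuousOn.div ?_ (by fun_prop) fun r _ => pow_ne_zero 2 (hne r))
    fun_prop
  · simp only [hT, radialFlux_zero hη.map_zero, hη.map_zero, hη.zero]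
    field_simp
    simp

lemma IsProfile.laplaceCoeff_eq (hη : IsProfile w R η θ) (hx : ‖x‖ ≤ R) (i j : Fin m) :
    laplaceCoeff (modelMetric m w) i j x = η ‖x‖ ^ (m - 1) * (η ‖x‖)⁻¹ ^ 2 * (1 : Matrix _ _ ℝ) i j +
      η ‖x‖ ^ (m - 1) * (1 - (η ‖x‖)⁻¹ ^ 2) * radialProj x i j := by
  rw [laplaceCoeff, hη.volumeDensity_eq hx, hη.modelMetric_inv hx]
  simp only [Matrix.add_apply, Matrix.smul_apply, Matrix.sub_apply, smul_eq_mul]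
  ring

lemma hasFDerivAt_coord (i : Fin m) :
    HasFDerivAt (fun y : Coord m => y i) (innerSL ℝ (EuclideanSpace.single i (1 : ℝ))) x := by
  refine (innerSL ℝ (EuclideanSpace.single i (1 : ℝ))).hasFDerivAt.congr_of_eventuallyEq
    (Eventually.of_forall fun y => ?_)
  simp [EuclideanSpace.inner_single_left]

lemma abs_radialProj_le (i j : Fin m) : |radialProj x i j| ≤ 1 := by
  have h : ∀ k, |‖x‖⁻¹ * x k| ≤ 1 := fun k => by
    rw [abs_mul, abs_inv, abs_norm, inv_mul_eq_div]
    exact div_le_one_of_le₀ (PiLp.norm_apply_le x k) (norm_nonneg x)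
  rw [radialProj_apply, abs_mul]
  exact mul_le_one₀ (h i) (abs_nonneg _) (h j)

/-- The only delicate point is the center: the factor 1 - η⁻² of the radial projection vanishes
there together with its derivative, since η'(0) = 0. -/
lemma IsProfile.differentiableAt_laplaceCoeff (hη : IsProfile w R η θ)
    (hx : x ∈ Metric.ball 0 R) (i j : Fin m) :
    DifferentiableAt ℝ (laplaceCoeff (modelMetric m w) i j) x := by
  have hev : laplaceCoeff (modelMetric m w) i j =ᶠ[𝓝 x] fun x =>
      η ‖x‖ ^ (m - 1) * (η ‖x‖)⁻¹ ^ 2 * (1 : Matrix _ _ ℝ) i j +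
      η ‖x‖ ^ (m - 1) * (1 - (η ‖x‖)⁻¹ ^ 2) * radialProj x i j := by
    filter_upwards [Metric.isOpen_ball.mem_nhds hx] with y hy
    exact hη.laplaceCoeff_eq (by simpa using (mem_ball_zero_iff.1 hy).le) i j
  refine DifferentiableAt.congr_of_eventuallyEq ?_ hev
  have hpos := hη.pos
  rcases eq_or_ne x 0 with rfl | h
  · have h1 : HasDerivAt (fun r => η r ^ (m - 1) * (η r)⁻¹ ^ 2) 0 0 := by
      have := (hη.hasDerivAt_zero.pow (m - 1)).mul ((hη.hasDerivAt_zero.inv (hpos 0).ne').pow 2)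
      refine this.congr_deriv ?_
      simp
    have h2 : HasDerivAt (fun r => η r ^ (m - 1) * (1 - (η r)⁻¹ ^ 2)) 0 0 := by
      have := (hη.hasDerivAt_zero.pow (m - 1)).mul
        (((hη.hasDerivAt_zero.inv (hpos 0).ne').pow 2).const_sub 1)
      refine this.congr_deriv ?_
      simp
    refine ((hasFDerivAt_comp_norm_zero h1).differentiableAt.mul_const _).add ?_
    exact (hasFDerivAt_mul_bounded_zero (C := 1) (fun y => abs_radialProj_le i j)
      (hasFDerivAt_comp_norm_zero h2) (by simp [hη.map_zero])).differentiableAt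
  · have hn := norm_pos_iff.2 h
    have hnorm : DifferentiableAt ℝ (fun y : Coord m => ‖y‖) x :=
      (hasFDerivAt_norm_of_ne_zero h).differentiableAt
    have hd : DifferentiableAt ℝ (fun y : Coord m => η ‖y‖) x :=
      (hη.hasDerivAt ‖x‖ ⟨hn, by simpa using hx⟩).differentiableAt.comp x hnorm
    have hdi : DifferentiableAt ℝ (fun y : Coord m => (η ‖y‖)⁻¹) x := hd.inv (hpos _).ne'
    have hni : DifferentiableAt ℝ (fun y : Coord m => ‖y‖⁻¹) x := hnorm.inv hn.ne'
    have hi := (hasFDerivAt_coord (x := x) i).differentiableAt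
    have hj := (hasFDerivAt_coord (x := x) j).differentiableAt
    simp only [radialProj_apply]
    exact (((hd.pow _).mul (hdi.pow 2)).mul_const _).add (((hd.pow _).mul
      ((hdi.pow 2).const_sub 1)).mul ((hni.mul hi).mul (hni.mul hj)))

lemma IsProfile.exists_laplaceCoeff_eq_mul_transpose (hη : IsProfile w R η θ) (hx : ‖x‖ ≤ R) :
    ∃ B : Matrix (Fin m) (Fin m) ℝ,
      ∀ i j, laplaceCoeff (modelMetric m w) i j x = (B * B.transpose) i j := by
  refine ⟨√(η ‖x‖ ^ (m - 1)) • (radialProj x + (η ‖x‖)⁻¹ • (1 - radialProj x)), fun i j => ?_⟩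
  have h := pow_pos (hη.pos ‖x‖) (m - 1)
  rw [laplaceCoeff, hη.volumeDensity_eq hx, hη.modelMetric_inv hx]
  simp only [Matrix.transpose_smul, Matrix.transpose_add, Matrix.transpose_sub,
    Matrix.transpose_one, radialProj_transpose, smul_mul_smul_comm, radialProj_add_mul,
    Real.mul_self_sqrt h.le, sq]
  simp only [Matrix.smul_apply, smul_eq_mul]

lemma IsProfile.laplaceBeltrami_nonneg_of_isLocalMin (hη : IsProfile w R η θ) {z : Coord m → ℝ}
    (hx : x ∈ Metric.ball 0 R) (hz : ContDiffAt ℝ 2 z x) (hmin : IsLocalMin z x) :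
    0 ≤ laplaceBeltrami (modelMetric m w) z x := by
  obtain ⟨B, hB⟩ := hη.exists_laplaceCoeff_eq_mul_transpose (x := x)
    (by simpa using (mem_ball_zero_iff.1 hx).le)
  exact WarpedModel.laplaceBeltrami_nonneg_of_isLocalMin
    (hη.differentiableAt_laplaceCoeff hx) hB hz hmin

lemma IsProfile.sum_laplaceCoeff_mul (hη : IsProfile w R η θ) (hx : ‖x‖ ≤ R) (i : Fin m) :
    ∑ j, laplaceCoeff (modelMetric m w) i j x * x j = η ‖x‖ ^ (m - 1) * x i := by
  have h1 : ∑ j, radialProj x i j * x j = x i := congrFun radialProj_mulVec_self i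
  simp only [hη.laplaceCoeff_eq hx, add_mul, Finset.sum_add_distrib, mul_assoc, ← Finset.mul_sum,
    h1, Matrix.one_apply, ite_mul, one_mul, zero_mul, Finset.sum_ite_eq, Finset.mem_univ, if_true]
  ring

/-- Radial vectors are fixed by the projection, so the density times the gradient is the field
-T(‖x‖) x. Its divergence is -(m T + r T'), which is -η^{m-1} g by the derivative of the flux; at
the center T(0) = g(0)/m is used instead. -/
lemma IsProfile.laplaceBeltrami_radialGreen (hη : IsProfile w R η θ) (hm : 1 ≤ m)
    (hg : Continuous g) (hx : x ∈ Metric.ball 0 R) :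
    laplaceBeltrami (modelMetric m w) (fun y => radialGreen (m - 1) η R g ‖y‖) x = -g ‖x‖ := by
  set T := radialFlux (m - 1) η g with hT
  have hTc : Continuous T := continuous_radialFlux hη.continuous hg
  have hmem : ∀ {y : Coord m}, y ∈ Metric.ball 0 R → ‖y‖ ≤ R := fun hy => by
    simpa using (mem_ball_zero_iff.1 hy).le
  have hne : ∀ r, η r ^ (m - 1) ≠ 0 := fun r => (pow_pos (hη.pos r) _).ne'
  have hgrad : ∀ j (y : Coord m), partialDeriv j (fun y => radialGreen (m - 1) η R g ‖y‖) y =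
      -(T ‖y‖ / η ‖y‖ ^ (m - 1)) * y j := by
    intro j y
    have h1 := hasDerivAt_radialGreen (d := m - 1) (R := R) hη.continuous hη.pos hg ‖y‖
    rw [← hT] at h1
    rcases eq_or_ne y 0 with rfl | h
    · have h2 : HasDerivAt (radialGreen (m - 1) η R g) 0 0 := by simpa using h1
      rw [partialDeriv, (hasFDerivAt_comp_norm_zero h2).fderiv]
      simp
    · have hn := norm_ne_zero_iff.2 h
      rw [partialDeriv, (hasFDerivAt_comp_norm_of_ne_zero h h1).fderiv]
      simp only [_root_.smul_apply, innerSL_apply_apply, smul_eq_mul,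
        EuclideanSpace.inner_single_right]
      have := hne ‖y‖
      simp
      field_simp
  have hflux : ∀ i, (fun y => ∑ j, laplaceCoeff (modelMetric m w) i j y *
      partialDeriv j (fun y => radialGreen (m - 1) η R g ‖y‖) y) =ᶠ[𝓝 x]
      fun y => -T ‖y‖ * y i := by
    intro i
    filter_upwards [Metric.isOpen_ball.mem_nhds hx] with y hy
    have h1 := hη.sum_laplaceCoeff_mul (hmem hy) i
    have := hne ‖y‖
    calc _ = -(T ‖y‖ / η ‖y‖ ^ (m - 1)) *
          ∑ j, laplaceCoeff (modelMetric m w) i j y * y j := by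
          rw [Finset.mul_sum]
          refine Finset.sum_congr rfl fun j _ => ?_
          rw [hgrad]
          ring
      _ = _ := by
          rw [h1]
          field_simp
  rw [laplaceBeltrami_eq_div, hη.volumeDensity_eq (hmem hx)]
  simp only [partialDeriv_congr (hflux _)]
  have hm1 : ((m - 1 : ℕ) : ℝ) + 1 = m := by
    rw [← Nat.cast_add_one, Nat.sub_add_cancel hm]
  rcases eq_or_ne x 0 with rfl | h
  · have h1 : ∀ i, partialDeriv i (fun y : Coord m => -T ‖y‖ * y i) 0 = -T 0 := fun i => by
      rw [partialDeriv, (hasFDerivAt_mul_of_eq_zero (c := fun y : Coord m => -T ‖y‖)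
        (by fun_prop) (hasFDerivAt_coord i) (by simp)).fderiv]
      simp
    have hm0 : (m : ℝ) ≠ 0 := by positivity
    rw [Finset.sum_congr rfl fun i _ => h1 i, hT]
    simp only [radialFlux_zero hη.map_zero, hm1, norm_zero, hη.map_zero, one_pow, inv_one,
      one_mul, Finset.sum_const, Finset.card_univ, Fintype.card_fin, nsmul_eq_mul]
    field_simp
  · have hn := norm_ne_zero_iff.2 h
    have h1 : ∀ i, partialDeriv i (fun y : Coord m => -T ‖y‖ * y i) x = -T ‖x‖ -
        (η ‖x‖ ^ (m - 1) * g ‖x‖ - m * T ‖x‖) / ‖x‖ ^ 2 * (x i * x i) := fun i => by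
      have h2 := (hasDerivAt_radialFlux (d := m - 1) hη.continuous hg hn).fun_neg
      rw [hm1, ← hT] at h2
      rw [partialDeriv, ((hasFDerivAt_comp_norm_of_ne_zero h h2).fun_mul
        (hasFDerivAt_coord i)).fderiv]
      simp [EuclideanSpace.inner_single_right]
      field_simp
      ring
    have h3 : ∑ i, x i * x i = ‖x‖ ^ 2 := dotProduct_self_eq_norm_sq x
    simp only [h1, Finset.sum_sub_distrib, ← Finset.mul_sum, h3, Finset.sum_const,
      Finset.card_univ, Fintype.card_fin, nsmul_eq_mul]
    have := hne ‖x‖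
    field_simp
    ring

end Profile

end

end WarpedModel

namespace WarpedModel

noncomputable section

variable {m : ℕ} {w η θ g : ℝ → ℝ} {R : ℝ} {L : EReal} {x : Coord m}

section Warping

open Filter Topology Asymptotics

lemma convex_base (L : EReal) : Convex ℝ (base L) := by
  refine Set.OrdConnected.convex ⟨fun a ha b hb c hc => ⟨ha.1.trans hc.1, ?_⟩⟩
  exact (EReal.coe_le_coe_iff.2 hc.2).trans_lt hb.2

lemma mem_base (hRL : (R : EReal) < L) {r : ℝ} (hr : r ∈ Set.Icc 0 R) : r ∈ base L :=
  ⟨hr.1, (EReal.coe_le_coe_iff.2 hr.2).trans_lt hRL⟩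

lemma base_mem_nhds {r : ℝ} (hr : 0 < r) (hrL : (r : EReal) < L) : base L ∈ 𝓝 r := by
  have h : IsOpen {r : ℝ | (r : EReal) < L} :=
    isOpen_Iio.preimage continuous_coe_real_ereal
  filter_upwards [h.mem_nhds hrL, lt_mem_nhds hr] with s hs hs0
  exact ⟨hs0.le, hs⟩

lemma uniqueDiffOn_base (hR : 0 < R) (hRL : (R : EReal) < L) : UniqueDiffOn ℝ (base L) :=
  uniqueDiffOn_convex (convex_base L) ⟨R, mem_interior_iff_mem_nhds.2 (base_mem_nhds hR hRL)⟩

/-- Second-order Taylor expansion with w(0) = 0, w'(0) = 1, w''(0) = 0. Division by r makes w(r)/r -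
1 of order o(r), the source of η'(0) = 0. -/
lemma IsWarpingFunction.sub_isLittleO (hw : IsWarpingFunction L w) (hR : 0 < R)
    (hRL : (R : EReal) < L) : (fun r => w r - r) =o[𝓝[base L] 0] fun r => r ^ 2 := by
  have h0 : (0 : ℝ) ∈ base L := mem_base hRL ⟨le_rfl, hR.le⟩
  have h := taylor_isLittleO (n := 2) (convex_base L) h0
    (contDiffOn_infty.1 hw.smooth 2)
  simp only [sub_zero] at h
  refine h.congr_left fun r => ?_
  have h1 : iteratedDerivWithin 1 w (base L) 0 = 1 := by
    rw [iteratedDerivWithin_one, hw.deriv_zero]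
  have h2 := hw.even_deriv_zero 2 even_two
  rw [taylorWithinEval_succ, taylorWithinEval_succ, taylor_within_zero_eval, zero_add, h1,
    one_add_one_eq_two, h2, hw.map_zero]
  simp

lemma IsWarpingFunction.exists_profile (hw : IsWarpingFunction L w) (hR : 0 < R)
    (hRL : (R : EReal) < L) : ∃ η θ : ℝ → ℝ, IsProfile w R η θ := by
  have h0 : (0 : ℝ) ∈ base L := mem_base hRL ⟨le_rfl, hR.le⟩
  have hU := uniqueDiffOn_base hR hRL
  set a : ℝ → ℝ := fun r => if r = 0 then 1 else w r / r with ha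
  have ha0 : a 0 = 1 := if_pos rfl
  have hane : ∀ {r : ℝ}, r ≠ 0 → a r = w r / r := fun h => if_neg h
  let p : ℝ → ℝ := fun r => max 0 (min R r)
  have hp : Continuous p := by fun_prop
  have hpmem : ∀ r, p r ∈ Set.Icc 0 R := fun r => ⟨le_max_left _ _, max_le hR.le (min_le_left _ _)⟩
  have hpid : ∀ {r}, r ∈ Set.Icc 0 R → p r = r := fun {r} hr => by
    simp only [p]
    rw [min_eq_right hr.2, max_eq_right hr.1]
  have hlo : (fun r => a r - 1) =o[𝓝[base L] 0] fun r => r := by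
    have h1 := hw.sub_isLittleO hR hRL
    rw [isLittleO_iff] at h1 ⊢
    intro c hc
    filter_upwards [h1 hc] with r hr
    rcases eq_or_ne r 0 with rfl | hne
    · simp [ha0]
    · have hn := abs_pos.2 hne
      have e : a r - 1 = (w r - r) / r := by
        rw [hane hne]
        field_simp
      rw [e, norm_div, div_le_iff₀ (norm_pos_iff.2 hne)]
      calc ‖w r - r‖ ≤ c * ‖r ^ 2‖ := hr
        _ = c * ‖r‖ * ‖r‖ := by rw [norm_pow]; ring
  have hacont : ContinuousOn a (Set.Icc 0 R) := by
    intro r hr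
    rcases eq_or_ne r 0 with rfl | hne
    · have h1 : Tendsto (fun r => a r - 1) (𝓝[base L] 0) (𝓝 0) :=
        hlo.trans_tendsto (tendsto_nhdsWithin_of_tendsto_nhds tendsto_id)
      have h2 : Tendsto a (𝓝[base L] 0) (𝓝 (a 0)) := by
        rw [ha0]
        exact tendsto_sub_nhds_zero_iff.1 h1
      exact h2.mono_left (nhdsWithin_mono _ fun s hs => mem_base hRL hs)
    · have h1 : ContinuousWithinAt (fun r => w r / r) (Set.Icc 0 R) r :=
        ((hw.smooth.continuousOn.mono fun s hs => mem_base hRL hs) r hr).div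
          continuousWithinAt_id hne
      refine h1.congr_of_eventuallyEq ?_ (hane hne)
      filter_upwards [nhdsWithin_le_nhds (isOpen_ne.mem_nhds hne)] with s hs using hane hs
  have hapos : ∀ r ∈ Set.Icc 0 R, 0 < a r := by
    intro r hr
    rcases hr.1.eq_or_lt with rfl | h
    · rw [ha0]
      exact one_pos
    · rw [hane h.ne']
      exact div_pos (hw.pos r (mem_base hRL hr) h) h
  have hp0 : p 0 = 0 := hpid ⟨le_rfl, hR.le⟩
  -- η is w(r)/r frozen outside [0, R], in particular equal to 1 for r ≤ 0, so its two-sided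
  -- derivative at 0 exists. From (w/r)' = (w' - w/r)/r comes θ = w' - η.
  refine ⟨fun r => a (p r), fun r => derivWithin w (base L) r - a (p r), ?_, ?_, ?_, ?_, ?_, ?_, ?_,
    ?_⟩
  · exact hacont.comp_continuous hp hpmem
  · exact fun r => hapos _ (hpmem r)
  · simp only [hp0, ha0]
  · intro r hr
    simp only [hpid hr]
    rcases eq_or_ne r 0 with rfl | h
    · rw [hw.map_zero, zero_mul]
    · rw [hane h, mul_div_cancel₀ _ h]
  · rw [hasDerivAt_iff_isLittleO_nhds_zero]
    have ht : Tendsto p (𝓝 0) (𝓝[base L] 0) := by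
      refine tendsto_nhdsWithin_iff.2 ⟨?_, Eventually.of_forall fun r => mem_base hRL (hpmem r)⟩
      simpa only [hp0] using hp.tendsto 0
    have h1 : p =O[𝓝 0] fun r => r := IsBigO.of_bound 1 (Eventually.of_forall fun r => by
      rw [one_mul, Real.norm_eq_abs, Real.norm_eq_abs, abs_of_nonneg (hpmem r).1]
      exact max_le (abs_nonneg r) ((min_le_right _ _).trans (le_abs_self r)))
    refine ((hlo.comp_tendsto ht).trans_isBigO h1).congr_left fun r => ?_
    simp [hp0, ha0]
  · intro r hr
    have hrI : r ∈ Set.Icc 0 R := ⟨hr.1.le, hr.2.le⟩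
    have hrb := mem_base hRL hrI
    have hd : HasDerivAt w (derivWithin w (base L) r) r :=
      ((hw.smooth.differentiableOn (by simp)) r hrb).hasDerivWithinAt.hasDerivAt
        (base_mem_nhds hr.1 hrb.2)
    have h1 := hd.div (hasDerivAt_id r) hr.1.ne'
    have hev : (fun r => a (p r)) =ᶠ[𝓝 r] w / id := by
      filter_upwards [isOpen_Ioo.mem_nhds hr] with s hs
      rw [hpid ⟨hs.1.le, hs.2.le⟩, hane hs.1.ne']
      rfl
    refine (h1.congr_of_eventuallyEq hev).congr_deriv ?_
    rw [hpid hrI, hane hr.1.ne']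
    have := hr.1.ne'
    simp only [id]
    field_simp
  · refine ContinuousOn.sub ?_ (hacont.comp_continuous hp hpmem).continuousOn
    exact (hw.smooth.continuousOn_derivWithin hU (by simp)).mono fun s hs =>
      mem_base hRL ⟨hs.1, hs.2.le⟩
  · simp only [hp0, ha0, hw.deriv_zero, sub_self]

/-! ### Geodesic balls about the center -/

lemma dotProduct_radialProj_mulVec (v : Coord m) :
    v.ofLp ⬝ᵥ (radialProj x).mulVec v.ofLp = (‖x‖⁻¹ * inner ℝ x v) ^ 2 := by
  have h : (‖x‖⁻¹ • x).ofLp ⬝ᵥ v.ofLp = ‖x‖⁻¹ * inner ℝ x v := by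
    rw [WithLp.ofLp_smul, smul_dotProduct, smul_eq_mul, EuclideanSpace.inner_eq_star_dotProduct,
      dotProduct_comm]
    rfl
  rw [radialProj, Matrix.vecMulVec_mulVec, dotProduct_smul, dotProduct_comm v.ofLp, h]
  simp [sq]

/-- The discarded tangential part is nonnegative by Cauchy-Schwarz. -/
lemma IsProfile.sq_le_metric (hη : IsProfile w R η θ) (hx : ‖x‖ ≤ R) (v : Coord m) :
    (‖x‖⁻¹ * inner ℝ x v) ^ 2 ≤ v.ofLp ⬝ᵥ (modelMetric m w x).mulVec v.ofLp := by
  rw [hη.modelMetric_eq hx, Matrix.add_mulVec, Matrix.smul_mulVec, Matrix.sub_mulVec,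
    Matrix.one_mulVec, dotProduct_add, dotProduct_smul, dotProduct_sub,
    dotProduct_radialProj_mulVec, dotProduct_self_eq_norm_sq]
  refine le_add_of_nonneg_right (smul_nonneg (sq_nonneg _) (sub_nonneg.2 ?_))
  refine sq_le_sq.2 ?_
  rw [abs_mul, abs_inv, abs_norm, abs_norm, inv_mul_eq_div]
  exact div_le_of_le_mul₀ (norm_nonneg _) (norm_nonneg _)
    ((abs_real_inner_le_norm x v).trans_eq (mul_comm _ _))

lemma IsProfile.continuousOn_modelMetric (hη : IsProfile w R η θ) (i j : Fin m) :
    ContinuousOn (fun x => modelMetric m w x i j) (Metric.closedBall 0 R) := by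
  have hηc := hη.continuous
  have h : Continuous fun x : Coord m => η ‖x‖ ^ 2 * (1 : Matrix (Fin m) (Fin m) ℝ) i j +
      (1 - η ‖x‖ ^ 2) * radialProj x i j := by
    refine Continuous.add (by fun_prop) (continuous_iff_continuousAt.2 fun x => ?_)
    rcases eq_or_ne x 0 with rfl | hx
    · have h1 : Tendsto (fun x : Coord m => 1 - η ‖x‖ ^ 2) (𝓝 0) (𝓝 0) := by
        have : Continuous fun x : Coord m => 1 - η ‖x‖ ^ 2 := by fun_prop
        simpa [hη.map_zero] using this.tendsto 0
      have h2 := bdd_le_mul_tendsto_zero' (f := fun x : Coord m => radialProj x i j) 1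
        (Eventually.of_forall fun x => abs_radialProj_le i j) h1
      simpa [ContinuousAt, mul_comm] using h2
    · have hn := norm_ne_zero_iff.2 hx
      have h1 : ContinuousAt (fun x : Coord m => ‖x‖⁻¹) x := by fun_prop (disch := exact hn)
      simp only [radialProj_apply]
      fun_prop
  refine h.continuousOn.congr fun x hx => ?_
  simp only [hη.modelMetric_eq (mem_closedBall_zero_iff.1 hx), Matrix.add_apply, Matrix.smul_apply,
    Matrix.sub_apply, smul_eq_mul]
  ring

/-- The radial speed is at most the Riemannian speed. As ‖γ‖ need not be differentiable at its
zeros, √(ε² + ‖γ‖²) is integrated instead and ε tends to 0. -/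
lemma IsProfile.norm_le_curveLength (hη : IsProfile w R η θ) {γ : ℝ → Coord m}
    (hγ : ContDiffOn ℝ 1 γ (Set.Icc 0 1)) (hγR : ∀ t ∈ Set.Icc (0 : ℝ) 1, ‖γ t‖ ≤ R)
    (h0 : γ 0 = 0) : ‖γ 1‖ ≤ curveLength (modelMetric m w) γ := by
  set γ' : ℝ → Coord m := derivWithin γ (Set.Icc 0 1) with hγ'
  have hγ'c : ContinuousOn γ' (Set.Icc 0 1) :=
    hγ.continuousOn_derivWithin (uniqueDiffOn_Icc zero_lt_one) le_rfl
  set f : ℝ → ℝ := fun t => √((γ' t).ofLp ⬝ᵥ (modelMetric m w (γ t)).mulVec (γ' t).ofLp) with hf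
  have hfc : ContinuousOn f (Set.Icc 0 1) := by
    refine ContinuousOn.sqrt ?_
    have h1 : ∀ i, ContinuousOn (fun t => γ' t i) (Set.Icc 0 1) := fun i t ht =>
      ContinuousAt.comp_continuousWithinAt (f := γ') (g := fun y : Coord m => y i)
        (hasFDerivAt_coord i).continuousAt (hγ'c t ht)
    have h2 : ∀ i j, ContinuousOn (fun t => modelMetric m w (γ t) i j) (Set.Icc 0 1) :=
      fun i j => (hη.continuousOn_modelMetric i j).comp hγ.continuousOn fun t ht =>
        mem_closedBall_zero_iff.2 (hγR t ht)
    simp only [dotProduct, Matrix.mulVec]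
    exact continuousOn_finsetSum _ fun i _ => (h1 i).mul
      (continuousOn_finsetSum _ fun j _ => (h2 i j).mul (h1 j))
  have hfle : ∀ t ∈ Set.Icc (0 : ℝ) 1, |‖γ t‖⁻¹ * inner ℝ (γ t) (γ' t)| ≤ f t := fun t ht =>
    Real.abs_le_sqrt (hη.sq_le_metric (hγR t ht) _)
  refine le_of_forall_pos_le_add fun ε hε => ?_
  have hpos : ∀ t, 0 < ε ^ 2 + ‖γ t‖ ^ 2 := fun t => by positivity
  have key := intervalIntegral.sub_le_integral_of_hasDeriv_right_of_le zero_le_one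
    (g := fun t => √(ε ^ 2 + ‖γ t‖ ^ 2)) (φ := f)
    (g' := fun t => inner ℝ (γ t) (γ' t) / √(ε ^ 2 + ‖γ t‖ ^ 2)) ?_ ?_ ?_ ?_
  · simp only [h0, norm_zero] at key
    rw [zero_pow two_ne_zero, add_zero, Real.sqrt_sq hε.le] at key
    have h1 : ‖γ 1‖ ≤ √(ε ^ 2 + ‖γ 1‖ ^ 2) :=
      Real.le_sqrt_of_sq_le (le_add_of_nonneg_left (sq_nonneg ε))
    change _ ≤ curveLength (modelMetric m w) γ at key
    linarith
  · have := hγ.continuousOn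
    fun_prop
  · intro t ht
    have h1 : HasDerivAt γ (γ' t) t :=
      ((hγ.differentiableOn one_ne_zero) t ⟨ht.1.le, ht.2.le⟩).hasDerivWithinAt.hasDerivAt
        (Icc_mem_nhds ht.1 ht.2)
    have h2 := ((h1.norm_sq.const_add (ε ^ 2)).sqrt (hpos t).ne').hasDerivWithinAt (s := Set.Ioi t)
    refine h2.congr_deriv ?_
    rw [mul_div_mul_left _ _ two_ne_zero]
  · exact hfc.integrableOn_Icc
  · intro t ht
    have htI : t ∈ Set.Icc (0 : ℝ) 1 := ⟨ht.1.le, ht.2.le⟩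
    refine le_trans ?_ (hfle t htI)
    rcases eq_or_ne (γ t) 0 with h | h
    · simp [h]
    · have hn := norm_pos_iff.2 h
      have h1 : ‖γ t‖ ≤ √(ε ^ 2 + ‖γ t‖ ^ 2) :=
        Real.le_sqrt_of_sq_le (le_add_of_nonneg_left (sq_nonneg ε))
      rw [abs_mul, abs_inv, abs_norm, inv_mul_eq_div]
      calc inner ℝ (γ t) (γ' t) / √(ε ^ 2 + ‖γ t‖ ^ 2)
          ≤ |inner ℝ (γ t) (γ' t)| / √(ε ^ 2 + ‖γ t‖ ^ 2) := by
            gcongr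
            exact le_abs_self _
        _ ≤ _ := by gcongr

lemma IsProfile.curveLength_segment (hη : IsProfile w R η θ) (hx : ‖x‖ ≤ R) :
    curveLength (modelMetric m w) (fun t => t • x) = ‖x‖ := by
  have h : ∀ t ∈ Set.uIcc (0 : ℝ) 1,
      √((derivWithin (fun t : ℝ => t • x) (Set.Icc 0 1) t).ofLp ⬝ᵥ
        (modelMetric m w (t • x)).mulVec
          (derivWithin (fun t : ℝ => t • x) (Set.Icc 0 1) t).ofLp) = ‖x‖ := by
    intro t ht
    rw [Set.uIcc_of_le zero_le_one] at ht
    have hd : derivWithin (fun t : ℝ => t • x) (Set.Icc 0 1) t = x := by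
      have h1 : HasDerivAt (fun t : ℝ => t • x) x t := by
        simpa using (hasDerivAt_id t).smul_const x
      exact h1.hasDerivWithinAt.derivWithin (uniqueDiffOn_Icc zero_lt_one t ht)
    have hg : (modelMetric m w (t • x)).mulVec x.ofLp = x.ofLp := by
      rcases eq_or_ne t 0 with rfl | h0
      · simp [modelMetric]
      · have hle : ‖t • x‖ ≤ R := by
          rw [norm_smul, Real.norm_eq_abs, abs_of_nonneg ht.1]
          exact (mul_le_of_le_one_left (norm_nonneg x) ht.2).trans hx
        have h1 : (radialProj (t • x)).mulVec x.ofLp = x.ofLp := by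
          have h2 := radialProj_mulVec_self (x := t • x)
          rw [WithLp.ofLp_smul, Matrix.mulVec_smul] at h2
          exact smul_right_injective _ h0 h2
        rw [hη.modelMetric_eq hle, Matrix.add_mulVec, Matrix.smul_mulVec, Matrix.sub_mulVec,
          Matrix.one_mulVec, h1, sub_self, smul_zero, add_zero]
    rw [hd, hg, dotProduct_self_eq_norm_sq, Real.sqrt_sq (norm_nonneg x)]
  rw [curveLength, intervalIntegral.integral_congr h]
  simp

lemma IsWarpingFunction.modelBall_eq (hw : IsWarpingFunction L w) (hR : 0 < R)
    (hRL : (R : EReal) < L) (m : ℕ) : modelBall m L w R = Metric.ball 0 R := by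
  ext x
  rw [mem_ball_zero_iff]
  constructor
  · rintro ⟨γ, hγ, hmaps, h0, rfl, hlen⟩
    obtain ⟨t, ht, hmax⟩ := isCompact_Icc.exists_isMaxOn (Set.nonempty_Icc.2 zero_le_one)
      hγ.continuousOn.norm
    -- The curve could a priori leave the ball of radius R, so the profile is taken up to its
    -- farthest point, which still lies in the carrier.
    obtain ⟨η, θ, hη⟩ := hw.exists_profile (R := max R ‖γ t‖) (lt_max_of_lt_left hR) (by
      rcases max_choice R ‖γ t‖ with h | h <;> rw [h]
      · exact hRL
      · exact hmaps ht)
    exact (hη.norm_le_curveLength hγ (fun s hs => (hmax hs).trans (le_max_right _ _)) h0).trans_lt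
      hlen
  · intro hx
    obtain ⟨η, θ, hη⟩ := hw.exists_profile hR hRL
    refine ⟨fun t => t • x, ContDiff.contDiffOn (by fun_prop), fun t ht => ?_, by simp, by simp, ?_⟩
    · refine (EReal.coe_le_coe_iff.2 ?_).trans_lt hRL
      rw [norm_smul, Real.norm_eq_abs, abs_of_nonneg ht.1]
      exact (mul_le_of_le_one_left (norm_nonneg x) ht.2).trans hx.le
    · rwa [hη.curveLength_segment hx.le]

end Warping

/-! ### Integrals of radial functions -/

lemma IsProfile.volumeIntegral_radial (hη : IsProfile w R η θ) (hm : 1 ≤ m) (hR : 0 < R) :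
    ∃ c : ℝ, 0 < c ∧ ∀ (F : Coord m → ℝ) (f : ℝ → ℝ), (∀ x ∈ Metric.ball 0 R, F x = f ‖x‖) →
      volumeIntegral (modelMetric m w) (Metric.ball 0 R) F = c * radialFlux (m - 1) η f R := by
  have : Nonempty (Fin m) := ⟨⟨0, hm⟩⟩
  -- m times the volume of the unit ball is the area of the unit sphere; R^m undoes the
  -- normalisation of the flux at R.
  refine ⟨m * (MeasureTheory.volume : MeasureTheory.Measure (Coord m)).real (Metric.ball 0 1) * R ^ m,
    ?_, fun F f hF => ?_⟩
  · have h1 : 0 < (MeasureTheory.volume : MeasureTheory.Measure (Coord m)).real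
        (Metric.ball 0 1) :=
      ENNReal.toReal_pos (Metric.measure_ball_pos _ _ one_pos).ne' MeasureTheory.measure_ball_lt_top.ne
    have h2 : (0 : ℝ) < m := by exact_mod_cast hm
    positivity
  · have h1 : volumeIntegral (modelMetric m w) (Metric.ball 0 R) F =
        ∫ x : Coord m, (Set.Iio R).indicator (fun r => f r * η r ^ (m - 1)) ‖x‖ := by
      rw [volumeIntegral, ← MeasureTheory.integral_indicator measurableSet_ball]
      congr 1
      ext x
      by_cases hx : x ∈ Metric.ball 0 R
      · have hx' := mem_ball_zero_iff.1 hx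
        rw [Set.indicator_of_mem hx, Set.indicator_of_mem (Set.mem_Iio.2 hx'), hF x hx,
          hη.volumeDensity_eq hx'.le]
      · rw [Set.indicator_of_notMem hx, Set.indicator_of_notMem]
        simpa using hx
    have h2 : ∫ y in Set.Ioi (0 : ℝ), y ^ (m - 1) •
        (Set.Iio R).indicator (fun r => f r * η r ^ (m - 1)) y =
        ∫ y in (0 : ℝ)..R, (y * η y) ^ (m - 1) * f y := by
      rw [intervalIntegral.integral_of_le hR.le, MeasureTheory.integral_Ioc_eq_integral_Ioo,
        ← Set.Ioi_inter_Iio, ← MeasureTheory.setIntegral_indicator measurableSet_Iio]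
      congr 1
      ext y
      by_cases hy : y ∈ Set.Iio R
      · rw [Set.indicator_of_mem hy, Set.indicator_of_mem hy, smul_eq_mul]
        ring
      · rw [Set.indicator_of_notMem hy, Set.indicator_of_notMem hy, smul_zero]
    rw [h1, MeasureTheory.integral_fun_norm_addHaar, finrank_euclideanSpace_fin, h2,
      ← pow_mul_radialFlux, Nat.sub_add_cancel hm]
    simp only [nsmul_eq_mul, smul_eq_mul]
    ring

end

end WarpedModel

namespace WarpedModel

noncomputable section

variable {m : ℕ} {w η θ g : ℝ → ℝ} {R : ℝ} {L : EReal} {x : Coord m}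

/-! ### Maximum principle and strict supersolutions -/

section Comparison

open Filter Topology

lemma laplaceBeltrami_const {g : Coord m → Matrix (Fin m) (Fin m) ℝ} (c : ℝ) :
    laplaceBeltrami g (fun _ => c) x = 0 := by
  simp [laplaceBeltrami, partialDeriv]

lemma IsProfile.laplaceBeltrami_linear (hη : IsProfile w R η θ) {z₁ z₂ : Coord m → ℝ}
    (h₁ : ContDiffOn ℝ 2 z₁ (Metric.ball 0 R)) (h₂ : ContDiffOn ℝ 2 z₂ (Metric.ball 0 R))
    (hx : x ∈ Metric.ball 0 R) (c₁ c₂ : ℝ) :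
    laplaceBeltrami (modelMetric m w) (fun y => c₁ * z₁ y + c₂ * z₂ y) x =
      c₁ * laplaceBeltrami (modelMetric m w) z₁ x +
        c₂ * laplaceBeltrami (modelMetric m w) z₂ x :=
  WarpedModel.laplaceBeltrami_linear (hη.differentiableAt_laplaceCoeff hx)
    (h₁.contDiffAt (Metric.isOpen_ball.mem_nhds hx))
    (h₂.contDiffAt (Metric.isOpen_ball.mem_nhds hx)) c₁ c₂

lemma IsProfile.laplaceBeltrami_const_mul (hη : IsProfile w R η θ) {z : Coord m → ℝ}
    (hz : ContDiffOn ℝ 2 z (Metric.ball 0 R)) (hx : x ∈ Metric.ball 0 R) (c : ℝ) :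
    laplaceBeltrami (modelMetric m w) (fun y => c * z y) x =
      c * laplaceBeltrami (modelMetric m w) z x := by
  simpa using hη.laplaceBeltrami_linear hz hz hx c 0

/-- `h` is a positive strict supersolution of `Δ h + lam h = 0` on the ball of radius `R`. -/
structure IsStrictSupersolution (m : ℕ) (w : ℝ → ℝ) (R lam : ℝ) (h : Coord m → ℝ) : Prop where
  contDiffOn : ContDiffOn ℝ 2 h (Metric.ball 0 R)
  continuousOn : ContinuousOn h (Metric.closedBall 0 R)
  pos : ∀ x ∈ Metric.closedBall 0 R, 0 < h x
  lt : ∀ x ∈ Metric.ball 0 R, laplaceBeltrami (modelMetric m w) h x + lam * h x < 0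

/-- Suppose v/h has a positive maximum M, necessarily at an interior point. There M h - v has a
local minimum with value 0, so its Laplacian is nonnegative, yet it equals M (Δh + lam h) < 0. -/
lemma IsStrictSupersolution.solution_nonpos {lam : ℝ} {h v : Coord m → ℝ}
    (hh : IsStrictSupersolution m w R lam h) (hη : IsProfile w R η θ)
    (hv : ContDiffOn ℝ 2 v (Metric.ball 0 R)) (hvc : ContinuousOn v (Metric.closedBall 0 R))
    (hveq : ∀ x ∈ Metric.ball 0 R, laplaceBeltrami (modelMetric m w) v x + lam * v x = 0)
    (hv0 : ∀ x ∈ Metric.sphere 0 R, v x = 0) : ∀ x ∈ Metric.ball 0 R, v x ≤ 0 := by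
  intro x₁ hx₁
  by_contra! hpos
  have hx₁' := Metric.ball_subset_closedBall hx₁
  obtain ⟨x₀, hx₀, hmax⟩ := (isCompact_closedBall (0 : Coord m) R).exists_isMaxOn ⟨x₁, hx₁'⟩
    (hvc.div hh.continuousOn fun x hx => (hh.pos x hx).ne')
  set M := v x₀ / h x₀ with hM
  have hMpos : 0 < M := (div_pos hpos (hh.pos x₁ hx₁')).trans_le (hmax hx₁')
  have hx₀b : x₀ ∈ Metric.ball 0 R := by
    rw [← Metric.ball_union_sphere] at hx₀
    refine hx₀.resolve_right fun hs => ?_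
    rw [hM, hv0 x₀ hs, zero_div] at hMpos
    exact lt_irrefl _ hMpos
  have hvx₀ : v x₀ = M * h x₀ := (div_mul_cancel₀ _ (hh.pos x₀ hx₀).ne').symm
  have hmin : IsLocalMin (fun y => M * h y + (-1) * v y) x₀ := by
    filter_upwards [Metric.isOpen_ball.mem_nhds hx₀b] with y hy
    have hy' := Metric.ball_subset_closedBall hy
    have h1 : v y ≤ M * h y := (div_le_iff₀ (hh.pos y hy')).1 (hmax hy')
    rw [hvx₀]
    linarith
  have h1 := hη.laplaceBeltrami_nonneg_of_isLocalMin hx₀b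
    (((contDiffOn_const.mul hh.contDiffOn).add (contDiffOn_const.mul hv)).contDiffAt
      (Metric.isOpen_ball.mem_nhds hx₀b)) hmin
  rw [hη.laplaceBeltrami_linear hh.contDiffOn hv hx₀b] at h1
  have h2 := hveq x₀ hx₀b
  have h3 := mul_neg_of_pos_of_neg hMpos (hh.lt x₀ hx₀b)
  rw [hvx₀] at h2
  linarith

lemma IsStrictSupersolution.solution_eq_zero {lam : ℝ} {h v : Coord m → ℝ}
    (hh : IsStrictSupersolution m w R lam h) (hη : IsProfile w R η θ)
    (hv : ContDiffOn ℝ 2 v (Metric.ball 0 R)) (hvc : ContinuousOn v (Metric.closedBall 0 R))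
    (hveq : ∀ x ∈ Metric.ball 0 R, laplaceBeltrami (modelMetric m w) v x + lam * v x = 0)
    (hv0 : ∀ x ∈ Metric.sphere 0 R, v x = 0) : ∀ x ∈ Metric.ball 0 R, v x = 0 := by
  intro x hx
  refine le_antisymm (hh.solution_nonpos hη hv hvc hveq hv0 x hx) ?_
  have h1 := hh.solution_nonpos (v := fun y => (-1) * v y) hη (contDiffOn_const.mul hv)
    (continuousOn_const.mul hvc) (fun y hy => ?_) (fun y hy => by rw [hv0 y hy, mul_zero]) x hx
  · linarith
  · rw [hη.laplaceBeltrami_const_mul hv hy]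
    linarith [hveq y hy]

lemma IsProfile.contDiffOn_momentProfile (hη : IsProfile w R η θ) (k : ℕ) :
    ContDiffOn ℝ 2 (fun x : Coord m => momentProfile (m - 1) η R k ‖x‖) (Metric.ball 0 R) := by
  cases k with
  | zero => exact contDiffOn_const
  | succ k => exact hη.contDiffOn_radialGreen (continuous_momentProfile hη.continuous hη.pos k) _

lemma IsProfile.laplaceBeltrami_momentProfile (hη : IsProfile w R η θ) (hm : 1 ≤ m) (k : ℕ)
    (hx : x ∈ Metric.ball 0 R) :
    laplaceBeltrami (modelMetric m w) (fun y => momentProfile (m - 1) η R (k + 1) ‖y‖) x =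
      -momentProfile (m - 1) η R k ‖x‖ :=
  hη.laplaceBeltrami_radialGreen hm (continuous_momentProfile hη.continuous hη.pos k) hx

/-- The sum telescopes, since Δ G_{j+1} = -G_j; only the last term survives. -/
lemma IsProfile.sum_pow_mul_momentProfile (hη : IsProfile w R η θ) (hm : 1 ≤ m) (lam : ℝ) (n : ℕ) :
    ContDiffOn ℝ 2 (fun x : Coord m => ∑ j ∈ Finset.range (n + 1),
      lam ^ j * momentProfile (m - 1) η R j ‖x‖) (Metric.ball 0 R) ∧
    ∀ x : Coord m, x ∈ Metric.ball 0 R → laplaceBeltrami (modelMetric m w)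
      (fun x => ∑ j ∈ Finset.range (n + 1), lam ^ j * momentProfile (m - 1) η R j ‖x‖) x +
      lam * ∑ j ∈ Finset.range (n + 1), lam ^ j * momentProfile (m - 1) η R j ‖x‖ =
        lam ^ (n + 1) * momentProfile (m - 1) η R n ‖x‖ := by
  refine ⟨ContDiffOn.sum fun j _ => contDiffOn_const.mul (hη.contDiffOn_momentProfile j), ?_⟩
  induction n with
  | zero =>
    intro x _
    simp [momentProfile, laplaceBeltrami_const]
  | succ n ih =>
    intro x hx
    have h1 : ContDiffOn ℝ 2 (fun x : Coord m => ∑ j ∈ Finset.range (n + 1),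
        lam ^ j * momentProfile (m - 1) η R j ‖x‖) (Metric.ball 0 R) :=
      ContDiffOn.sum fun j _ => contDiffOn_const.mul (hη.contDiffOn_momentProfile j)
    have h2 := hη.laplaceBeltrami_linear h1 (hη.contDiffOn_momentProfile (n + 1)) hx 1
      (lam ^ (n + 1))
    simp only [one_mul] at h2
    simp only [Finset.sum_range_succ _ (n + 1)]
    rw [h2, hη.laplaceBeltrami_momentProfile hm n hx]
    have h3 := ih x hx
    rw [mul_add, pow_succ lam (n + 1)]
    linarith

/-- Choose n with lam < c_n. The partial sum has defect lam^{n+1} G_n and is positive up to the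
boundary thanks to its term G_0 = 1; adding s G_{n+1} changes the defect by at most -s (1 - lam/c_n)
G_n. -/
lemma IsProfile.exists_strictSupersolution (hη : IsProfile w R η θ) (hm : 1 ≤ m) (hR : 0 < R)
    {lam : ℝ} (hlam : lam < radialEigenvalue (m - 1) η R) :
    ∃ h : Coord m → ℝ, IsStrictSupersolution m w R lam h := by
  rcases lt_or_ge lam 0 with hneg | hnn
  · refine ⟨fun _ => 1, contDiffOn_const, continuousOn_const, fun _ _ => one_pos, fun x _ => ?_⟩
    rw [laplaceBeltrami_const]
    linarith
  obtain ⟨n, hn⟩ := exists_lt_of_lt_ciSup hlam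
  set c := momentRatio (m - 1) η R n with hc
  have hcpos : 0 < c := momentRatio_pos hη.continuous hη.pos hR n
  obtain ⟨hS, hSeq⟩ := hη.sum_pow_mul_momentProfile (m := m) hm lam n
  have hlt : 0 < 1 - lam / c := sub_pos.2 ((div_lt_one hcpos).2 hn)
  -- This s makes the total defect at most -G_n, which is negative inside the ball.
  set s := (lam ^ (n + 1) + 1) / (1 - lam / c) with hs
  have hspos : 0 < s := by positivity
  have hGc := continuous_momentProfile (d := m - 1) (R := R) hη.continuous hη.pos
  have hGnn := momentProfile_nonneg (d := m - 1) hη.continuous hη.pos hR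
  refine ⟨fun x => 1 * (∑ j ∈ Finset.range (n + 1), lam ^ j * momentProfile (m - 1) η R j ‖x‖) +
    s * momentProfile (m - 1) η R (n + 1) ‖x‖,
    (contDiffOn_const.mul hS).add (contDiffOn_const.mul (hη.contDiffOn_momentProfile _)),
    Continuous.continuousOn ?_, fun x hx => ?_, fun x hx => ?_⟩
  · exact (continuous_const.mul (continuous_finsetSum _ fun j _ =>
      continuous_const.mul ((hGc j).comp continuous_norm))).add
      (continuous_const.mul ((hGc _).comp continuous_norm))
  · have hxI : ‖x‖ ∈ Set.Icc 0 R := ⟨norm_nonneg x, mem_closedBall_zero_iff.1 hx⟩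
    rw [Finset.sum_range_succ', one_mul]
    have h1 : 0 ≤ ∑ j ∈ Finset.range n, lam ^ (j + 1) * momentProfile (m - 1) η R (j + 1) ‖x‖ :=
      Finset.sum_nonneg fun j _ => mul_nonneg (pow_nonneg hnn _) (hGnn _ _ hxI)
    have h2 := mul_nonneg hspos.le (hGnn (n + 1) _ hxI)
    have h3 : lam ^ 0 * momentProfile (m - 1) η R 0 ‖x‖ = 1 := by simp [momentProfile]
    linarith
  · have hxI : ‖x‖ ∈ Set.Ico 0 R := ⟨norm_nonneg x, mem_ball_zero_iff.1 hx⟩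
    have h1 := momentRatio_mul_le (d := m - 1) hη.continuous hη.pos hR n ⟨hxI.1, hxI.2.le⟩
    have h2 := momentProfile_pos (d := m - 1) hη.continuous hη.pos hR n _ hxI
    have h3 := hSeq x hx
    rw [hη.laplaceBeltrami_linear hS (hη.contDiffOn_momentProfile _) hx,
      hη.laplaceBeltrami_momentProfile hm n hx]
    have h4 : momentProfile (m - 1) η R (n + 1) ‖x‖ ≤ momentProfile (m - 1) η R n ‖x‖ / c := by
      rw [le_div_iff₀ hcpos, mul_comm]
      exact h1
    have h5 : s * (1 - lam / c) = lam ^ (n + 1) + 1 := div_mul_cancel₀ _ hlt.ne'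
    have h6 := mul_le_mul_of_nonneg_left h4 (mul_nonneg hspos.le hnn)
    have h7 : s * lam * (momentProfile (m - 1) η R n ‖x‖ / c) =
        (s - (lam ^ (n + 1) + 1)) * momentProfile (m - 1) η R n ‖x‖ := by
      rw [← h5]
      ring
    linarith

end Comparison

/-! ### The Dirichlet problems on a ball -/

lemma IsProfile.isLeast_radialEigenvalue (hη : IsProfile w R η θ) (hm : 1 ≤ m) (hR : 0 < R) :
    IsLeast {lam : ℝ | IsDirichletEigenvalue (modelMetric m w) (Metric.ball 0 R) lam}
      (radialEigenvalue (m - 1) η R) := by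
  constructor
  · obtain ⟨f, hf, hf0, hfeq⟩ := exists_radial_eigenfunction (d := m - 1) hη.continuous hη.pos hR
    refine ⟨fun x => radialGreen (m - 1) η R f ‖x‖, hη.contDiffOn_radialGreen hf _,
      ((continuous_radialGreen hη.continuous hη.pos hf).comp continuous_norm).continuousOn,
      fun x hx => ?_, fun x hx => ?_, 0, Metric.mem_ball_self hR, fun h => ?_⟩
    · rw [hη.laplaceBeltrami_radialGreen hm hf hx,
        ← hfeq ‖x‖ ⟨norm_nonneg x, (mem_ball_zero_iff.1 hx).le⟩, neg_add_cancel]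
    · rw [frontier_ball _ hR.ne'] at hx
      simp [mem_sphere_zero_iff_norm.1 hx]
    · have h1 := hfeq 0 ⟨le_rfl, hR.le⟩
      simp only [norm_zero] at h
      rw [h, mul_zero, hf0] at h1
      exact one_ne_zero h1
  · rintro lam ⟨v, hv, hvc, hveq, hv0, x, hx, hne⟩
    rw [closure_ball _ hR.ne'] at hvc
    rw [frontier_ball _ hR.ne'] at hv0
    by_contra! hlt
    obtain ⟨h, hh⟩ := hη.exists_strictSupersolution hm hR hlt
    exact hne (hh.solution_eq_zero hη hv hvc hveq hv0 x hx)

lemma IsProfile.isMomentSequence (hη : IsProfile w R η θ) (hm : 1 ≤ m) (hR : 0 < R) :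
    IsMomentSequence (modelMetric m w) (Metric.ball 0 R)
      fun k x => k.factorial * momentProfile (m - 1) η R k ‖x‖ where
  zero x _ := by simp [momentProfile]
  contDiffOn k _ := contDiffOn_const.mul (hη.contDiffOn_momentProfile k)
  continuousOn k _ := (continuous_const.mul
    ((continuous_momentProfile hη.continuous hη.pos k).comp continuous_norm)).continuousOn
  equation k hk x hx := by
    obtain ⟨j, rfl⟩ := Nat.exists_eq_succ_of_ne_zero (Nat.one_le_iff_ne_zero.1 hk)
    rw [hη.laplaceBeltrami_const_mul (hη.contDiffOn_momentProfile _) hx,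
      hη.laplaceBeltrami_momentProfile hm j hx, Nat.succ_sub_one, Nat.factorial_succ]
    push_cast
    ring
  boundary k hk x hx := by
    obtain ⟨j, rfl⟩ := Nat.exists_eq_succ_of_ne_zero (Nat.one_le_iff_ne_zero.1 hk)
    rw [frontier_ball _ hR.ne'] at hx
    rw [mem_sphere_zero_iff_norm.1 hx, momentProfile_succ_self, mul_zero]

lemma IsProfile.momentSequence_eq (hη : IsProfile w R η θ) (hm : 1 ≤ m) (hR : 0 < R)
    {u : ℕ → Coord m → ℝ} (hu : IsMomentSequence (modelMetric m w) (Metric.ball 0 R) u) (k : ℕ) :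
    ∀ x ∈ Metric.ball 0 R, u k x = k.factorial * momentProfile (m - 1) η R k ‖x‖ := by
  have hs := hη.isMomentSequence hm hR
  -- A supersolution for lam = 0, available because 0 < c_0 ≤ λ; it forces the difference of two
  -- solutions with equal right-hand sides to vanish.
  obtain ⟨h, hh⟩ := hη.exists_strictSupersolution hm hR
    ((momentRatio_pos hη.continuous hη.pos hR 0).trans_le
      (momentRatio_le_radialEigenvalue (d := m - 1) hη.continuous hη.pos hR 0))
  induction k with
  | zero =>
    intro x hx
    rw [hu.zero x hx, hs.zero x hx]
  | succ k ih =>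
    have hk : 1 ≤ k + 1 := Nat.le_add_left 1 k
    have h1 := hh.solution_eq_zero hη
      (v := fun y => 1 * u (k + 1) y +
        (-1) * ((k + 1).factorial * momentProfile (m - 1) η R (k + 1) ‖y‖))
      ((contDiffOn_const.mul (hu.contDiffOn _ hk)).add (contDiffOn_const.mul (hs.contDiffOn _ hk)))
      ?_ (fun x hx => ?_) (fun x hx => ?_)
    · intro x hx
      linarith [h1 x hx]
    · rw [← closure_ball _ hR.ne']
      exact (continuousOn_const.mul (hu.continuousOn _ hk)).add
        (continuousOn_const.mul (hs.continuousOn _ hk))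
    · have h2 := hu.equation _ hk x hx
      have h3 := hs.equation _ hk x hx
      rw [hη.laplaceBeltrami_linear (hu.contDiffOn _ hk) (hs.contDiffOn _ hk) hx]
      simp only [Nat.add_sub_cancel] at h2 h3
      rw [ih x hx] at h2
      linarith
    · rw [← frontier_ball _ hR.ne'] at hx
      rw [hu.boundary _ hk x hx, hs.boundary _ hk x hx]
      ring

end

end WarpedModel

/-! ### The main theorem -/

theorem mainTheorem2 (m : ℕ) (hm : 1 ≤ m) (L : EReal) (w : ℝ → ℝ)
    (hw : WarpedModel.IsWarpingFunction L w) (R : ℝ) (hR : 0 < R) (hRL : (R : EReal) < L) :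
    -- the first eigenvalue and the moment functions exist
    IsLeast
      {lam : ℝ | WarpedModel.IsDirichletEigenvalue (WarpedModel.modelMetric m w)
        (WarpedModel.modelBall m L w R) lam}
      (WarpedModel.firstDirichletEigenvalue (WarpedModel.modelMetric m w)
        (WarpedModel.modelBall m L w R)) ∧
    (∃ u : ℕ → WarpedModel.Coord m → ℝ,
      WarpedModel.IsMomentSequence (WarpedModel.modelMetric m w)
        (WarpedModel.modelBall m L w R) u) ∧
    ∀ u : ℕ → WarpedModel.Coord m → ℝ,
      WarpedModel.IsMomentSequence (WarpedModel.modelMetric m w)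
        (WarpedModel.modelBall m L w R) u →
      ∀ k : ℕ, 1 ≤ k →
        -- the denominators are positive
        (∀ x ∈ WarpedModel.modelBall m L w R, 0 < u k x) ∧
        0 < WarpedModel.volumeIntegral (WarpedModel.modelMetric m w)
          (WarpedModel.modelBall m L w R) (u k) ∧
        -- the quotient is a radial function, increasing in the distance `r = ‖x‖` to the center
        (∃ φ : ℝ → ℝ, StrictMonoOn φ (Set.Ico 0 R) ∧
          ∀ x ∈ WarpedModel.modelBall m L w R, k * u (k - 1) x / u k x = φ ‖x‖) ∧
        -- the two bounds for the first eigenvalue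
        k * u (k - 1) 0 / u k 0 ≤
          WarpedModel.firstDirichletEigenvalue (WarpedModel.modelMetric m w)
            (WarpedModel.modelBall m L w R) ∧
        WarpedModel.firstDirichletEigenvalue (WarpedModel.modelMetric m w)
            (WarpedModel.modelBall m L w R) ≤
          k * WarpedModel.volumeIntegral (WarpedModel.modelMetric m w)
              (WarpedModel.modelBall m L w R) (u (k - 1)) /
            WarpedModel.volumeIntegral (WarpedModel.modelMetric m w)
              (WarpedModel.modelBall m L w R) (u k) := by
  rw [hw.modelBall_eq hR hRL]
  obtain ⟨η, θ, hη⟩ := hw.exists_profile hR hRL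
  have hleast := hη.isLeast_radialEigenvalue hm hR
  have hfirst : WarpedModel.firstDirichletEigenvalue (WarpedModel.modelMetric m w)
      (Metric.ball 0 R) = WarpedModel.radialEigenvalue (m - 1) η R := hleast.csInf_eq
  rw [hfirst]
  refine ⟨hleast, ⟨_, hη.isMomentSequence hm hR⟩, fun u hu k hk => ?_⟩
  obtain ⟨j, rfl⟩ := Nat.exists_eq_succ_of_ne_zero (Nat.one_le_iff_ne_zero.1 hk)
  have hueq := hη.momentSequence_eq hm hR hu
  have hGc := WarpedModel.continuous_momentProfile (d := m - 1) (R := R) hη.continuous hη.pos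
  have hGpos := WarpedModel.momentProfile_pos (d := m - 1) hη.continuous hη.pos hR
  have hfac : ∀ n : ℕ, (0 : ℝ) < n.factorial := fun n => by exact_mod_cast n.factorial_pos
  have hmem : ∀ x ∈ Metric.ball (0 : WarpedModel.Coord m) R, ‖x‖ ∈ Set.Ico 0 R := fun x hx =>
    ⟨norm_nonneg x, mem_ball_zero_iff.1 hx⟩
  obtain ⟨c, hc, hint⟩ := hη.volumeIntegral_radial hm hR
  have hA : ∀ n, WarpedModel.volumeIntegral (WarpedModel.modelMetric m w) (Metric.ball 0 R) (u n) =
      c * (n.factorial * WarpedModel.radialFlux (m - 1) η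
        (WarpedModel.momentProfile (m - 1) η R n) R) := fun n => by
    rw [hint (u n) (fun r => n.factorial * WarpedModel.momentProfile (m - 1) η R n r) (hueq n),
      WarpedModel.radialFlux_const_mul]
  have hflux : ∀ n, 0 < WarpedModel.radialFlux (m - 1) η
      (WarpedModel.momentProfile (m - 1) η R n) R := fun n =>
    WarpedModel.radialFlux_pos hη.continuous hη.pos (hGc n) (hGpos n) ⟨hR.le, le_rfl⟩ hR
  -- The factor k is absorbed by the factorials in u_k = k! G_k.
  have hquot : ∀ x ∈ Metric.ball (0 : WarpedModel.Coord m) R,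
      ((j.succ : ℕ) : ℝ) * u (j.succ - 1) x / u j.succ x =
        WarpedModel.momentProfile (m - 1) η R j ‖x‖ /
          WarpedModel.momentProfile (m - 1) η R (j + 1) ‖x‖ := fun x hx => by
    rw [Nat.succ_sub_one, hueq _ x hx, hueq _ x hx, Nat.factorial_succ, Nat.succ_eq_add_one,
      Nat.cast_mul, ← mul_assoc]
    have h1 := hfac j
    exact mul_div_mul_left _ _ (by positivity)
  refine ⟨fun x hx => ?_, ?_, ⟨_, WarpedModel.strictMonoOn_momentProfile_div (d := m - 1)
    hη.continuous hη.pos hR j, hquot⟩, ?_, ?_⟩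
  · rw [hueq _ x hx]
    exact mul_pos (hfac _) (hGpos _ _ (hmem x hx))
  · rw [hA]
    exact mul_pos hc (mul_pos (hfac _) (hflux _))
  · rw [hquot 0 (Metric.mem_ball_self hR), norm_zero]
    exact WarpedModel.momentRatio_le_radialEigenvalue hη.continuous hη.pos hR j
  · refine (WarpedModel.radialEigenvalue_le_flux_div hη.continuous hη.pos hR j).trans_eq ?_
    rw [Nat.succ_sub_one, hA, hA, Nat.factorial_succ, Nat.succ_eq_add_one, Nat.cast_mul]
    have h1 := hfac j
    have h2 := (hflux (j + 1)).ne'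
    field_simp
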